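/- Let $\mathcal J$ be the set of bounded Jacobi matrices $(Ju)_n=a_nu_{n+1}+a_{n-1}u_{n-1}+b_nu_n$ on $\ell^2(\mathbb Z)$, where $a_n>0$, $b_n\in\mathbb R$ are bounded sequences, and let $\mathcal P=\mathbb R[x]$ be the additive group of real polynomials. Let $n\in\mathbb Z$ act on $\mathcal J$ by $n\cdot J=S^nJ$, the Jacobi matrix with coefficients $(a_{k+n},b_{k+n})_{k\in\mathbb Z}$. For $p\in\mathcal P$ let $p\cdot J$ be the time one map of the Lax equation $\dot J=[p(J)_a,J]$ (derivative in operator norm), where, in terms of the matrix elements $X_{jk}=\langle\delta_j,X\delta_k\rangle$, $(X_a)_{jk}=X_{jk}$ for $j<k$, $(X_a)_{jk}=-X_{jk}$ for $j>k$, and $(X_a)_{jj}=0$. Let $$\mathbb{SL}=\{T:\mathbb C\to SL(2,\mathbb C)\ :\ T \text{ entire},\ T(x)\in SL(2,\mathbb R)\text{ for }x\in\mathbb R\},$$ a group under pointwise multiplication. Define the shift cocycle by $T(0;J)=1$, $$T(1;J)=A(J)=\begin{pmatrix}\frac{z-b_1}{a_1}&\frac1{a_1}\\-a_1&0\end{pmatrix},$$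 $T(n;J)=A((n-1)\cdot J)\cdots A(1\cdot J)A(J)$ and $T(-n;J)=T(n;(-n)\cdot J)^{-1}$ for $n\ge1$. For $k\ge 0$, $n\in\mathbb Z$, put $$G^{(k)}_n(z,J)=\sum_{j=0}^{k-1}z^{k-1-j}\langle\delta_n,J^j\delta_n\rangle,$$ $$H^{(k)}_n(z,J)=z^k-\langle\delta_n,J^k\delta_n\rangle+2a_n\sum_{j=1}^{k-1}z^{k-1-j}\langle\delta_n,SJ^j\delta_n\rangle,$$ where $(Su)_n=u_{n+1}$, and for $p=\sum c_kx^k$ put $G=\sum c_kG^{(k)}$, $H=\sum c_kH^{(k)}$ and $$B_p(z,J)=\begin{pmatrix}2(z-b_1)G_1-H_1&2G_1\\-2a_0^2G_0&-2(z-b_1)G_1+H_1\end{pmatrix}.$$ Let $T(p;J)$ be the value at $t=1$ of the solution of $\dot T=B_p(z,tp\cdot J)\,T$, $T(0)=1$. **Theorem.** The Lax equation has, for every $p\in\mathcal P$ and $J\in\mathcal J$, exactly one solution $J(t)\in\mathcal J$, $t\in\mathbb R$, with $J(0)=J$, and this solution is $t\mapsto tp\cdot J$; also, for every $z\in\mathbb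 C$, the equation $\dot T=B_p(z,tp\cdot J)\,T$, $T(0)=1$, has exactly one solution on $\mathbb R$, and this solution is $t\mapsto T(tp;J)(z)$. The maps $(p,n)\cdot J=p\cdot(S^nJ)=S^n(p\cdot J)$ define an action of the group $G=\mathcal P\times\mathbb Z$ on $\mathcal J$. The matrices $$T((p,n);J)=T(p;n\cdot J)\,T(n;J)=T(n;p\cdot J)\,T(p;J)$$ belong to $\mathbb{SL}$ and form an $\mathbb{SL}$-cocycle for this action: $$T(gh;J)=T(g;h\cdot J)\,T(h;J)\qquad\text{for all } g,h\in G,\ J\in\mathcal J .$$ -/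

import Mathlib

open Polynomial Matrix

noncomputable section

/-- The Hilbert space `ℓ²(ℤ)` of complex two-sided sequences. -/
abbrev EllTwo : Type := lp (fun _ : ℤ => ℂ) 2

/-- Square summability is preserved by translation and by a bounded weight. -/
theorem memlp_weightedShift (w : ℤ → ℝ) (hw : ∃ C : ℝ, ∀ n, |w n| ≤ C) (m : ℤ) (u : EllTwo) :
    Memℓp (fun n : ℤ => (w n : ℂ) * u (n + m)) 2 := by
  obtain ⟨C, hC⟩ := hw
  have h2 : (0 : ℝ) < (2 : ENNReal).toReal := by norm_num
  have hu : Summable fun n : ℤ => ‖u (n + m)‖ ^ (2 : ENNReal).toReal :=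
    ((Equiv.addRight m).summable_iff (f := fun n : ℤ => ‖u n‖ ^ (2 : ENNReal).toReal)).2
      ((lp.memℓp u).summable h2)
  refine memℓp_gen (Summable.of_nonneg_of_le (fun n => by positivity) (fun n => ?_)
    (hu.mul_left (C ^ (2 : ENNReal).toReal)))
  rw [norm_mul, Complex.norm_real, Real.norm_eq_abs,
    Real.mul_rpow (abs_nonneg _) (norm_nonneg _)]
  gcongr
  exact hC n

/-- The bounded operator `(W u)_n = w_n u_{n+m}` on `ℓ²(ℤ)`, for a bounded real sequence `w`. -/
def weightedShift (w : ℤ → ℝ) (hw : ∃ C : ℝ, ∀ n, |w n| ≤ C) (m : ℤ) : EllTwo →L[ℂ] EllTwo :=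
  LinearMap.mkContinuousOfExistsBound
    { toFun := fun u => ⟨fun n : ℤ => (w n : ℂ) * u (n + m), memlp_weightedShift w hw m u⟩
      map_add' := fun u v => by
        ext n
        exact mul_add _ _ _
      map_smul' := fun c u => by
        ext n
        simp [mul_left_comm] }
    (by
      obtain ⟨C, hC⟩ := hw
      have h2 : (0 : ℝ) < (2 : ENNReal).toReal := by norm_num
      have hC0 : 0 ≤ C := (abs_nonneg _).trans (hC 0)
      refine ⟨C, fun u => ?_⟩
      have hu : Summable fun n : ℤ => ‖u (n + m)‖ ^ (2 : ENNReal).toReal :=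
        ((Equiv.addRight m).summable_iff (f := fun n : ℤ => ‖u n‖ ^ (2 : ENNReal).toReal)).2
          ((lp.memℓp u).summable h2)
      have he : ∑' n : ℤ, ‖u (n + m)‖ ^ (2 : ENNReal).toReal
          = ∑' n : ℤ, ‖u n‖ ^ (2 : ENNReal).toReal :=
        (Equiv.addRight m).tsum_eq (fun n : ℤ => ‖u n‖ ^ (2 : ENNReal).toReal)
      rw [← Real.rpow_le_rpow_iff (norm_nonneg _) (by positivity) h2,
        Real.mul_rpow hC0 (norm_nonneg _), lp.norm_rpow_eq_tsum h2, lp.norm_rpow_eq_tsum h2, ← he,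
        ← tsum_mul_left]
      have hle : ∀ n : ℤ, ‖(w n : ℂ) * u (n + m)‖ ^ (2 : ENNReal).toReal
          ≤ C ^ (2 : ENNReal).toReal * ‖u (n + m)‖ ^ (2 : ENNReal).toReal := fun n => by
        rw [norm_mul, Complex.norm_real, Real.norm_eq_abs,
          Real.mul_rpow (abs_nonneg _) (norm_nonneg _)]
        gcongr
        exact hC n
      exact Summable.tsum_le_tsum hle
        (Summable.of_nonneg_of_le (fun n => by positivity) hle (hu.mul_left _)) (hu.mul_left _))

@[simp] theorem weightedShift_apply (w : ℤ → ℝ) (hw : ∃ C : ℝ, ∀ n, |w n| ≤ C) (m : ℤ)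
    (u : EllTwo) (n : ℤ) : weightedShift w hw m u n = (w n : ℂ) * u (n + m) := rfl

/-- The shift operator `(S u)_n = u_{n+1}` on `ℓ²(ℤ)`. -/
def shiftOp : EllTwo →L[ℂ] EllTwo := weightedShift (fun _ => 1) ⟨1, fun _ => by simp⟩ 1

/-- The matrix element `X_{jk} = ⟨δ_j, X δ_k⟩` with respect to the standard unit vectors. -/
def matElem (X : EllTwo →L[ℂ] EllTwo) (j k : ℤ) : ℂ :=
  inner ℂ (lp.single 2 j (1 : ℂ) : EllTwo) (X (lp.single 2 k (1 : ℂ)))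

/-- `Y` is the antisymmetric part `X_a` of `X`: the bounded operator with matrix
`(X_a)_{jk} = X_{jk}` for `j < k`, `-X_{jk}` for `j > k`, and `0` for `j = k`. -/
def IsAntisymmPart (X Y : EllTwo →L[ℂ] EllTwo) : Prop :=
  ∀ j k : ℤ, matElem Y j k =
    if j < k then matElem X j k else if k < j then -matElem X j k else 0

/-- The space `𝒥` of (bounded) Jacobi matrices, given by their bounded real coefficient sequences
`a_n > 0` and `b_n`. -/
@[ext]
structure JacobiMatrix where
  a : ℤ → ℝ
  b : ℤ → ℝ
  a_pos : ∀ n, 0 < a n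
  a_bdd : ∃ C : ℝ, ∀ n, |a n| ≤ C
  b_bdd : ∃ C : ℝ, ∀ n, |b n| ≤ C

namespace JacobiMatrix

/-- The operator `(J u)_n = a_n u_{n+1} + a_{n-1} u_{n-1} + b_n u_n` on `ℓ²(ℤ)`. -/
def toOp (J : JacobiMatrix) : EllTwo →L[ℂ] EllTwo :=
  weightedShift J.a J.a_bdd 1
    + weightedShift (fun n => J.a (n - 1)) (J.a_bdd.imp fun _ h n => h (n - 1)) (-1)
    + weightedShift J.b J.b_bdd 0

theorem toOp_apply (J : JacobiMatrix) (u : EllTwo) (n : ℤ) :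
    J.toOp u n = J.a n * u (n + 1) + J.a (n - 1) * u (n - 1) + J.b n * u n := by
  simp [toOp, sub_eq_add_neg]

/-- `S^n J`: the Jacobi matrix with the shifted coefficients `a_{k+n}`, `b_{k+n}`. -/
def shift (n : ℤ) (J : JacobiMatrix) : JacobiMatrix where
  a := fun k => J.a (k + n)
  b := fun k => J.b (k + n)
  a_pos := fun k => J.a_pos (k + n)
  a_bdd := J.a_bdd.imp fun _ h k => h (k + n)
  b_bdd := J.b_bdd.imp fun _ h k => h (k + n)

end JacobiMatrix

/-- `γ` is the global solution curve through `J` of the Lax equation `J̇ = [p(J)_a, J]`,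
the derivative being taken in operator norm. -/
def IsTodaFlow (p : ℝ[X]) (J : JacobiMatrix) (γ : ℝ → JacobiMatrix) : Prop :=
  γ 0 = J ∧ ∀ t : ℝ, ∃ Y : EllTwo →L[ℂ] EllTwo,
    IsAntisymmPart (aeval (γ t).toOp p) Y ∧
      HasDerivAt (fun s => (γ s).toOp) (Y * (γ t).toOp - (γ t).toOp * Y) t

open Classical in
/-- `p · J`, the time one map of the Toda flow. (The value `J` is used if there is no flow, which
never happens.) -/
def todaMap (p : ℝ[X]) (J : JacobiMatrix) : JacobiMatrix :=
  if h : ∃ γ : ℝ → JacobiMatrix, IsTodaFlow p J γ then h.choose 1 else J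

/-- The sequence `G^{(k)}_n(z, J) = ∑_{j=0}^{k-1} z^{k-1-j} ⟨δ_n, J^j δ_n⟩`. -/
def todaGMonomial (k : ℕ) (z : ℂ) (J : JacobiMatrix) (n : ℤ) : ℂ :=
  ∑ j ∈ Finset.range k, z ^ (k - 1 - j) * matElem (J.toOp ^ j) n n

/-- The sequence
`H^{(k)}_n(z, J) = z^k - ⟨δ_n, J^k δ_n⟩ + 2 a_n ∑_{j=1}^{k-1} z^{k-1-j} ⟨δ_n, S J^j δ_n⟩`. -/
def todaHMonomial (k : ℕ) (z : ℂ) (J : JacobiMatrix) (n : ℤ) : ℂ :=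
  z ^ k - matElem (J.toOp ^ k) n n
    + 2 * (J.a n : ℂ) *
      ∑ j ∈ Finset.Ico 1 k, z ^ (k - 1 - j) * matElem (shiftOp * J.toOp ^ j) n n

/-- `G_p = ∑ c_k G^{(k)}` for `p = ∑ c_k x^k`. -/
def todaG (p : ℝ[X]) (z : ℂ) (J : JacobiMatrix) (n : ℤ) : ℂ :=
  p.sum fun k c => (c : ℂ) * todaGMonomial k z J n

/-- `H_p = ∑ c_k H^{(k)}` for `p = ∑ c_k x^k`. -/
def todaH (p : ℝ[X]) (z : ℂ) (J : JacobiMatrix) (n : ℤ) : ℂ :=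
  p.sum fun k c => (c : ℂ) * todaHMonomial k z J n

/-- The matrix function `B_p(z, J)`. -/
def todaB (p : ℝ[X]) (z : ℂ) (J : JacobiMatrix) : Matrix (Fin 2) (Fin 2) ℂ :=
  !![2 * (z - J.b 1) * todaG p z J 1 - todaH p z J 1, 2 * todaG p z J 1;
    -2 * (J.a 0 : ℂ) ^ 2 * todaG p z J 0, -2 * (z - J.b 1) * todaG p z J 1 + todaH p z J 1]

/-- `M` solves `Ṁ = B_p(z, tp · J) M`, `M(0) = 1` on `ℝ`, for the given `z`. -/
def IsTodaTransfer (p : ℝ[X]) (J : JacobiMatrix) (z : ℂ)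
    (M : ℝ → Matrix (Fin 2) (Fin 2) ℂ) : Prop :=
  M 0 = 1 ∧ ∀ (t : ℝ) (i j : Fin 2),
    HasDerivAt (fun s => M s i j) ((todaB p z (todaMap (t • p) J) * M t) i j) t

open Classical in
/-- `T(p; J)(z)`: the solution of `Ṁ = B_p(z, tp · J) M`, `M(0) = 1`, evaluated at `t = 1`.
(The value `1` is used if there is no solution, which never happens.) -/
def todaTransfer (p : ℝ[X]) (J : JacobiMatrix) (z : ℂ) : Matrix (Fin 2) (Fin 2) ℂ :=
  if h : ∃ M : ℝ → Matrix (Fin 2) (Fin 2) ℂ, IsTodaTransfer p J z M then h.choose 1 else 1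

/-- The group of entire functions `T : ℂ → SL(2, ℂ)` with `T(x) ∈ SL(2, ℝ)` for `x ∈ ℝ`, with
pointwise multiplication. -/
def SLEntire : Subgroup (ℂ → Matrix.SpecialLinearGroup (Fin 2) ℂ) where
  carrier := {T | (∀ i j : Fin 2, Differentiable ℂ fun z => (T z : Matrix (Fin 2) (Fin 2) ℂ) i j) ∧
    ∀ (x : ℝ) (i j : Fin 2), ((T x : Matrix (Fin 2) (Fin 2) ℂ) i j).im = 0}
  one_mem' := by
    constructor
    · intro i j
      simp
    · intro x i j
      fin_cases i <;> fin_cases j <;> simp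
  mul_mem' := by
    rintro T U ⟨hT, hT'⟩ ⟨hU, hU'⟩
    constructor
    · intro i j
      simp only [Pi.mul_apply, Matrix.SpecialLinearGroup.coe_mul, Matrix.mul_apply,
        Fin.sum_univ_two]
      exact ((hT i 0).mul (hU 0 j)).add ((hT i 1).mul (hU 1 j))
    · intro x i j
      simp [Matrix.mul_apply, Fin.sum_univ_two, hT', hU']
  inv_mem' := by
    rintro T ⟨hT, hT'⟩
    constructor
    · intro i j
      simp only [Pi.inv_apply, Matrix.SpecialLinearGroup.coe_inv, Matrix.adjugate_fin_two]
      fin_cases i <;> fin_cases j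
      · exact hT 1 1
      · exact (hT 0 1).neg
      · exact (hT 1 0).neg
      · exact hT 0 0
    · intro x i j
      simp only [Pi.inv_apply, Matrix.SpecialLinearGroup.coe_inv, Matrix.adjugate_fin_two]
      fin_cases i <;> fin_cases j <;> simp [hT']

/-- The matrix in `SL(2, ℂ)` that `T ∈ SLEntire` takes as its value at `z`. -/
def SLEntire.eval (T : SLEntire) (z : ℂ) : Matrix (Fin 2) (Fin 2) ℂ := (T.1 z).1

/-- The one-step transfer matrix `A(J)`. -/
def stepMatrix (J : JacobiMatrix) : SLEntire :=
  ⟨fun z => ⟨!![(z - J.b 1) / J.a 1, 1 / J.a 1; -(J.a 1 : ℂ), 0], by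
      have h : (J.a 1 : ℂ) ≠ 0 := Complex.ofReal_ne_zero.2 (J.a_pos 1).ne'
      rw [Matrix.det_fin_two_of]
      field_simp
      ring⟩, by
    constructor
    · intro i j
      fin_cases i <;> fin_cases j <;> simp
    · intro x i j
      fin_cases i <;> fin_cases j <;>
        simp [← Complex.ofReal_sub, ← Complex.ofReal_div, ← Complex.ofReal_inv]⟩

/-- `T(n; J) = A((n-1) · J) ⋯ A(1 · J) A(J)` for `n ≥ 0`. -/
def shiftTransferNat : ℕ → JacobiMatrix → SLEntire
  | 0, _ => 1
  | n + 1, J => stepMatrix (J.shift n) * shiftTransferNat n J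

/-- The shift (transfer matrix) cocycle, extended to negative integers by
`T(-n; J) = T(n; (-n) · J)⁻¹`. -/
def shiftTransfer : ℤ → JacobiMatrix → SLEntire
  | Int.ofNat n, J => shiftTransferNat n J
  | Int.negSucc n, J => (shiftTransferNat (n + 1) (J.shift (Int.negSucc n)))⁻¹

/-- `T` is an `SLEntire`-cocycle for the action of `G` on `X`:
`T(gh, x) = T(g, h · x) T(h, x)`, with the group operation of `G` written additively. -/
def IsSLCocycle {G X : Type*} [AddGroup G] [AddAction G X] (T : G → X → SLEntire) : Prop :=
  ∀ (g h : G) (x : X), T (g + h) x = T g (h +ᵥ x) * T h x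

end

/-! Everything rests on one factorization. Along a Toda flow J(t) let U solve U' = YU, U(0) = 1,
where Y is the antisymmetric part of p(J(t)). Y is skew-adjoint, so U is unitary and J(t) = U J U*.
Moreover Y - p(J(t)) is lower and Y + p(J(t)) is upper triangular, hence U exp(-tp(J)) stays lower
triangular and U exp(tp(J)) stays upper triangular, both with positive diagonal
(`IsTodaFlow.exists_isDressing`). Such a U is unique (`IsDressing.unique`): for two of them, U V* is
unitary, both lower and upper triangular, and has positive diagonal. So U(t) depends only on the
operator tp(J). This gives uniqueness of the flow, identifies time t of p with time one of tp, makes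
the flows of different polynomials compose additively (`IsDressing.mul`), and yields equivariance
under the shift, since translations preserve triangularity.

Existence is an ODE in the Banach space of coefficient pairs. Unitary conjugation preserves the norm
of J, which excludes blow-up, and a_n' is a real multiple of a_n, which keeps a_n positive.

For the cocycle, put q(J) = (p(J) - p(z))/(J - z), a polynomial in J. Then G_n = q(J)_{n,n} and H_n
= p(z) - p(J)_{n,n} + 2 a_n q(J)_{n,n+1}. The operators W = U exp(∓(p(J) - p(z))) (`transportOp`)
intertwine J with p · J and are lower, respectively upper, triangular, so they carry solutions of Ju
= zu on a left, respectively right, half-line to solutions for p · J on the same half-line.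
Subtracting p(z) makes the data (u_1, -a_0 u_0) evolve by the same matrix B_p in both cases; thus
T(p; J) sends the data of u to the data of Wu. The W compose and commute with translations, so the
cocycle identities hold on such data. For nonreal z the data of left and right solutions in ℓ² span
ℂ² (`exists_initVec_eq`), and nonreal z are dense.

Holomorphy in z and reality on the real axis come from solving the matrix ODE in a Banach algebra of
functions of z with these properties; the determinant is 1 because B_p has trace zero. -/

noncomputable section

/-! ### Global existence and uniqueness for ODEs in Banach spaces -/

section ODE

/-- A linear vector field with continuous coefficients is Lipschitz locally uniformly in time. -/
theorem lipschitz_of_norm_sub_le {E : Type*} [NormedAddCommGroup E] {v : ℝ → E → E} {c : ℝ → ℝ}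
    (hc : Continuous c) (h : ∀ t x y, ‖v t x - v t y‖ ≤ c t * ‖x - y‖) (T : ℝ) :
    ∃ K : NNReal, ∀ t, |t| ≤ T → LipschitzWith K (v t) := by
  obtain ⟨C, hC⟩ : ∃ C : ℝ, ∀ t ∈ Set.Icc (-T) T, ‖c t‖ ≤ C :=
    isCompact_Icc.exists_bound_of_continuousOn hc.continuousOn
  refine ⟨C.toNNReal, fun t ht => LipschitzWith.of_dist_le_mul fun x y => ?_⟩
  rw [dist_eq_norm, dist_eq_norm]
  refine (h t x y).trans ?_
  gcongr
  exact ((le_abs_self _).trans (hC t (abs_le.1 ht))).trans (Real.le_coe_toNNReal _)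

variable {E : Type*} [NormedAddCommGroup E] [NormedSpace ℝ E]

/-- The radial retraction of a normed space to the closed ball of radius `R`. -/
def radialRetraction (R : ℝ) (x : E) : E := (R / max R ‖x‖) • x

theorem norm_radialRetraction_le {R : ℝ} (hR : 0 < R) (x : E) : ‖radialRetraction R x‖ ≤ R := by
  have h : 0 < max R ‖x‖ := lt_max_of_lt_left hR
  rw [radialRetraction, norm_smul, Real.norm_of_nonneg (by positivity), div_mul_eq_mul_div,
    div_le_iff₀ h]
  gcongr
  exact le_max_right _ _

theorem norm_radialRetraction_le_norm {R : ℝ} (hR : 0 < R) (x : E) :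
    ‖radialRetraction R x‖ ≤ ‖x‖ := by
  have h : 0 < max R ‖x‖ := lt_max_of_lt_left hR
  rw [radialRetraction, norm_smul, Real.norm_of_nonneg (by positivity)]
  exact mul_le_of_le_one_left (norm_nonneg _) ((div_le_one h).2 (le_max_left _ _))

theorem radialRetraction_of_norm_le {R : ℝ} (hR : 0 < R) {x : E} (hx : ‖x‖ ≤ R) :
    radialRetraction R x = x := by
  rw [radialRetraction, max_eq_left hx, div_self hR.ne', one_smul]

/-- In a general normed space the retraction need not be a contraction. Moving the vector and moving
the scaling factor each contribute at most ‖x - y‖, which gives the constant 2. -/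
theorem lipschitzWith_radialRetraction {R : ℝ} (hR : 0 < R) :
    LipschitzWith 2 (radialRetraction R : E → E) := by
  refine LipschitzWith.of_dist_le_mul fun x y => ?_
  have hs : 0 < max R ‖x‖ := lt_max_of_lt_left hR
  have hr : 0 < max R ‖y‖ := lt_max_of_lt_left hR
  rw [dist_eq_norm, dist_eq_norm]
  have e : radialRetraction R x - radialRetraction R y
      = (R / max R ‖x‖) • (x - y) + (R / max R ‖x‖ - R / max R ‖y‖) • y := by
    simp only [radialRetraction]; module
  have h1 : ‖(R / max R ‖x‖) • (x - y)‖ ≤ ‖x - y‖ := by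
    rw [norm_smul, Real.norm_of_nonneg (by positivity)]
    exact mul_le_of_le_one_left (norm_nonneg _) ((div_le_one hs).2 (le_max_left _ _))
  have h2 : ‖(R / max R ‖x‖ - R / max R ‖y‖) • y‖ ≤ ‖x - y‖ := by
    have e2 : R / max R ‖x‖ - R / max R ‖y‖
        = (R / max R ‖x‖) * (1 / max R ‖y‖) * (max R ‖y‖ - max R ‖x‖) := by
      field_simp
    have h3 : |max R ‖y‖ - max R ‖x‖| ≤ ‖x - y‖ := by
      refine (abs_max_sub_max_le_max _ _ _ _).trans ?_
      rw [sub_self, abs_zero, max_eq_right (abs_nonneg _), norm_sub_rev]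
      exact abs_norm_sub_norm_le _ _
    rw [norm_smul, e2, Real.norm_eq_abs, abs_mul, abs_of_nonneg (a := _ * _) (by positivity)]
    have h4 : R / max R ‖x‖ ≤ 1 := (div_le_one hs).2 (le_max_left _ _)
    have h5 : 1 / max R ‖y‖ * ‖y‖ ≤ 1 := by
      rw [one_div_mul_eq_div]
      exact (div_le_one hr).2 (le_max_right _ _)
    calc R / max R ‖x‖ * (1 / max R ‖y‖) * |max R ‖y‖ - max R ‖x‖| * ‖y‖
        = (R / max R ‖x‖) * (1 / max R ‖y‖ * ‖y‖) * |max R ‖y‖ - max R ‖x‖| := by ring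
      _ ≤ 1 * 1 * ‖x - y‖ := by gcongr
      _ = ‖x - y‖ := by ring
  rw [e]
  refine (norm_add_le _ _).trans ?_
  have : ((2 : NNReal) : ℝ) = 2 := rfl
  rw [this]; linarith

/-- Uniqueness of global solutions of `x' = v(t, x)`, where `v` is Lipschitz in `x` locally
uniformly in `t`. -/
theorem eq_of_global_solutions {v : ℝ → E → E}
    (hv : ∀ T : ℝ, ∃ K : NNReal, ∀ t, |t| ≤ T → LipschitzWith K (v t)) {f g : ℝ → E}
    (hf : ∀ t, HasDerivAt f (v t (f t)) t) (hg : ∀ t, HasDerivAt g (v t (g t)) t)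
    (h0 : f 0 = g 0) : f = g := by
  funext t
  obtain ⟨K, hK⟩ := hv (|t| + 1)
  have hT : 0 < |t| + 1 := by positivity
  refine ODE_solution_unique_of_mem_Ioo (v := v) (s := fun _ => Set.univ) (K := K)
    (a := -(|t| + 1)) (b := |t| + 1) (t₀ := 0)
    (fun s hs => (hK s (abs_le.2 ⟨hs.1.le, hs.2.le⟩)).lipschitzOnWith) ⟨by linarith, hT⟩
    (fun s _ => ⟨hf s, trivial⟩) (fun s _ => ⟨hg s, trivial⟩) h0 ?_
  exact ⟨by linarith [neg_abs_le t], by linarith [le_abs_self t]⟩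

/-- A bound for a curve whose speed grows at most linearly. -/
theorem norm_le_of_norm_deriv_le {x x' : ℝ → E} {T K C : ℝ}
    (hx : ∀ t ∈ Set.Icc 0 T, HasDerivWithinAt x (x' t) (Set.Icc 0 T) t)
    (hK : 0 ≤ K) (hC : 0 ≤ C) (h : ∀ t ∈ Set.Icc 0 T, ‖x' t‖ ≤ K * ‖x t‖ + C) :
    ∀ t ∈ Set.Icc 0 T, ‖x t‖ ≤ gronwallBound ‖x 0‖ K C T := by
  intro t ht
  have := norm_le_gronwallBound_of_norm_deriv_right_le (f := x) (f' := x') (δ := ‖x 0‖) (K := K)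
    (ε := C) (a := 0) (b := T) (fun s hs => (hx s hs).continuousWithinAt)
    (fun s hs => ((hx s (Set.Ico_subset_Icc_self hs)).mono_of_mem_nhdsWithin
      (Icc_mem_nhdsGE_of_mem hs))) le_rfl
    (fun s hs => h s (Set.Ico_subset_Icc_self hs)) t ht
  refine this.trans ?_
  rw [sub_zero]
  exact gronwallBound_mono (norm_nonneg _) hC hK ht.2

variable [CompleteSpace E]

/-- Picard–Lindelöf on all of [-T, T] needs a bounded field, so v is precomposed with the retraction
to a ball of radius R. Since v grows at most linearly, Gronwall bounds the solution by R, and the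
retraction is never felt. -/
theorem exists_solution_on_Icc {v : ℝ → E → E} {T : ℝ} (hT : 0 ≤ T) {K : NNReal}
    (hv : ∀ t, |t| ≤ T → LipschitzWith K (v t)) (hc : ∀ x, Continuous fun t => v t x) (x₀ : E) :
    ∃ x : ℝ → E, x 0 = x₀ ∧
      ∀ t ∈ Set.Icc (-T) T, HasDerivWithinAt x (v t (x t)) (Set.Icc (-T) T) t := by
  obtain ⟨C, hC⟩ : ∃ C : ℝ, ∀ t ∈ Set.Icc (-T) T, ‖v t 0‖ ≤ C :=
    isCompact_Icc.exists_bound_of_continuousOn (hc 0).continuousOn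
  have hC0 : 0 ≤ C := (norm_nonneg _).trans (hC 0 ⟨by linarith, hT⟩)
  have hlin : ∀ t ∈ Set.Icc (-T) T, ∀ x, ‖v t x‖ ≤ K * ‖x‖ + C := fun t ht x => by
    have h1 := (hv t (abs_le.2 ht)).dist_le_mul x 0
    rw [dist_eq_norm, dist_zero_right] at h1
    calc ‖v t x‖ = ‖(v t x - v t 0) + v t 0‖ := by rw [sub_add_cancel]
      _ ≤ ‖v t x - v t 0‖ + ‖v t 0‖ := norm_add_le _ _
      _ ≤ K * ‖x‖ + C := add_le_add h1 (hC t ht)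
  set R : ℝ := max 1 (gronwallBound ‖x₀‖ K C T) with hRdef
  have hR : 0 < R := lt_max_of_lt_left one_pos
  let w : ℝ → E → E := fun t x => v t (radialRetraction R x)
  -- The truncated field has speed at most K R + C, so in time T a curve travels at most (K R + C)
  -- T; this is taken as the radius of the Picard–Lindelöf ball.
  have hPL : IsPicardLindelof w (tmin := -T) (tmax := T) ⟨0, by constructor <;> linarith⟩ x₀
      (⟨K * R + C, by positivity⟩ * ⟨T, hT⟩ : NNReal) 0 ⟨K * R + C, by positivity⟩ (K * 2) := by
    constructor
    · intro t ht
      exact ((hv t (abs_le.2 ht)).comp (lipschitzWith_radialRetraction hR)).lipschitzOnWith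
    · intro x _
      exact (hc _).continuousOn
    · intro t ht x _
      refine (hlin t ht _).trans ?_
      change _ ≤ (K : ℝ) * R + C
      gcongr
      exact norm_radialRetraction_le hR x
    · change (K * R + C) * max (T - 0) (0 - -T) ≤ (K * R + C) * T - 0
      simp
  obtain ⟨x, hx0, hx⟩ := hPL.exists_eq_forall_mem_Icc_hasDerivWithinAt₀
  have hx0 : x 0 = x₀ := hx0
  refine ⟨x, hx0, fun t ht => ?_⟩
  have hw : ∀ t ∈ Set.Icc (-T) T, ‖w t (x t)‖ ≤ K * ‖x t‖ + C := fun t ht => by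
    refine (hlin t ht _).trans ?_
    gcongr
    exact norm_radialRetraction_le_norm hR _
  have hfw : ∀ t ∈ Set.Icc 0 T, ‖x t‖ ≤ gronwallBound ‖x 0‖ K C T := by
    refine norm_le_of_norm_deriv_le (x' := fun t => w t (x t)) (fun t ht => ?_) K.2 hC0
      fun t ht => hw t ⟨by linarith [ht.1], ht.2⟩
    exact (hx t ⟨by linarith [ht.1], ht.2⟩).mono (Set.Icc_subset_Icc (by linarith) le_rfl)
  -- Gronwall runs forward in time; negative times are handled by reversing the curve.
  have hbw : ∀ t ∈ Set.Icc 0 T, ‖x (-t)‖ ≤ gronwallBound ‖x (-0)‖ K C T := by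
    refine norm_le_of_norm_deriv_le (x := fun t => x (-t)) (x' := fun t => (-1 : ℝ) • w (-t) (x (-t)))
      (fun t ht => ?_) K.2 hC0 fun t ht => ?_
    · refine HasDerivWithinAt.scomp t (h := fun t : ℝ => -t)
        (hx (-t) ⟨by linarith [ht.2], by linarith [ht.1]⟩) (hasDerivAt_neg t).hasDerivWithinAt ?_
      intro s hs
      exact ⟨by linarith [hs.2], by linarith [hs.1]⟩
    · rw [norm_smul, norm_neg, norm_one, one_mul]
      exact hw (-t) ⟨by linarith [ht.2], by linarith [ht.1]⟩
  have hb : ‖x t‖ ≤ R := by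
    refine le_trans ?_ (le_max_right _ _)
    rcases le_total 0 t with h | h
    · simpa [hx0] using hfw t ⟨h, ht.2⟩
    · simpa [hx0] using hbw (-t) ⟨by linarith, by linarith [ht.1]⟩
  have := hx t ht
  simpa only [w, radialRetraction_of_norm_le hR hb] using this

/-- Global existence of solutions of `x' = v(t, x)`, where `v` is Lipschitz in `x` locally
uniformly in `t`. -/
theorem exists_global_solution {v : ℝ → E → E}
    (hv : ∀ T : ℝ, ∃ K : NNReal, ∀ t, |t| ≤ T → LipschitzWith K (v t))
    (hc : ∀ x, Continuous fun t => v t x) (x₀ : E) :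
    ∃ x : ℝ → E, x 0 = x₀ ∧ ∀ t, HasDerivAt x (v t (x t)) t := by
  have hex : ∀ n : ℕ, ∃ x : ℝ → E, x 0 = x₀ ∧
      ∀ t ∈ Set.Ioo (-((n : ℝ) + 1)) (n + 1), HasDerivAt x (v t (x t)) t := fun n => by
    obtain ⟨K, hK⟩ := hv (n + 1)
    obtain ⟨x, hx0, hx⟩ := exists_solution_on_Icc (by positivity) hK hc x₀
    exact ⟨x, hx0, fun t ht => (hx t (Set.Ioo_subset_Icc_self ht)).hasDerivAt
      (Icc_mem_nhds ht.1 ht.2)⟩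
  choose y hy0 hy using hex
  have huniq : ∀ m n : ℕ, m ≤ n → Set.EqOn (y m) (y n) (Set.Ioo (-((m : ℝ) + 1)) (m + 1)) :=
    fun m n hmn => by
    obtain ⟨K, hK⟩ := hv (m + 1)
    have hmn' : (m : ℝ) ≤ n := by exact_mod_cast hmn
    refine ODE_solution_unique_of_mem_Ioo (v := v) (s := fun _ => Set.univ) (K := K) (t₀ := 0)
      (fun s hs => (hK s (abs_le.2 ⟨hs.1.le, hs.2.le⟩)).lipschitzOnWith)
      ⟨by linarith [(Nat.cast_nonneg m : (0 : ℝ) ≤ m)], by positivity⟩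
      (fun s hs => ⟨hy m s hs, trivial⟩)
      (fun s hs => ⟨hy n s ⟨by linarith [hs.1], by linarith [hs.2]⟩, trivial⟩)
      ((hy0 m).trans (hy0 n).symm)
  have hagree : ∀ (m : ℕ) (t : ℝ), t ∈ Set.Ioo (-((m : ℝ) + 1)) (m + 1) →
      y ⌈|t|⌉₊ t = y m t := fun m t ht => by
    have h1 : t ∈ Set.Ioo (-((⌈|t|⌉₊ : ℝ) + 1)) (⌈|t|⌉₊ + 1) := by
      have := abs_le.1 (Nat.le_ceil |t|)
      exact ⟨by linarith [this.1], by linarith [this.2]⟩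
    rcases le_total ⌈|t|⌉₊ m with h | h
    · exact huniq _ _ h h1
    · exact (huniq _ _ h ht).symm
  -- The extra 1 in the intervals puts t in the open interval of index ⌈|t|⌉, so near t the glued
  -- curve agrees with a single local solution.
  refine ⟨fun t => y ⌈|t|⌉₊ t, by simp [hy0], fun t => ?_⟩
  have h1 : t ∈ Set.Ioo (-((⌈|t|⌉₊ : ℝ) + 1)) (⌈|t|⌉₊ + 1) := by
    have := abs_le.1 (Nat.le_ceil |t|)
    exact ⟨by linarith [this.1], by linarith [this.2]⟩
  refine (hy ⌈|t|⌉₊ t h1).congr_of_eventuallyEq ?_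
  filter_upwards [isOpen_Ioo.mem_nhds h1] with s hs
  exact hagree _ s hs

end ODE

/-! ### Linear equations in Banach algebras -/

section LinearODE

theorem lipschitz_mul_left {A : Type*} [NormedRing A] {Y : ℝ → A} (hY : Continuous Y) (T : ℝ) :
    ∃ K : NNReal, ∀ t, |t| ≤ T → LipschitzWith K (fun x => Y t * x) :=
  (lipschitz_of_norm_sub_le (c := fun t => ‖Y t‖) hY.norm fun t x y => by
    rw [← mul_sub]; exact norm_mul_le _ _) T

theorem lipschitz_commutator {A : Type*} [NormedRing A] {Y : ℝ → A} (hY : Continuous Y) (T : ℝ) :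
    ∃ K : NNReal, ∀ t, |t| ≤ T → LipschitzWith K (fun x => Y t * x - x * Y t) :=
  (lipschitz_of_norm_sub_le (c := fun t => 2 * ‖Y t‖) (hY.norm.const_mul 2) fun t x y => by
    have e : Y t * x - x * Y t - (Y t * y - y * Y t) = Y t * (x - y) - (x - y) * Y t := by
      noncomm_ring
    rw [e]
    refine (norm_sub_le _ _).trans ?_
    linarith [norm_mul_le (Y t) (x - y), norm_mul_le (x - y) (Y t)]) T

variable {A : Type*} [NormedRing A] [NormedAlgebra ℝ A] [CompleteSpace A]

/-- The solution of a linear equation in a Banach algebra stays in a closed subspace that is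
invariant under the coefficients. -/
theorem exists_linear_solution_mem {Y : ℝ → A} (hY : Continuous Y)
    (S : Submodule ℝ A) (hS : IsClosed (S : Set A)) (hYS : ∀ t, ∀ x ∈ S, Y t * x ∈ S)
    (h1 : (1 : A) ∈ S) :
    ∃ U : ℝ → A, U 0 = 1 ∧ (∀ t, HasDerivAt U (Y t * U t) t) ∧ ∀ t, U t ∈ S := by
  have : CompleteSpace S := hS.completeSpace_coe
  -- A closed subspace is itself a Banach space, and invariance lets the equation be solved inside
  -- it.
  obtain ⟨U, hU0, hU⟩ := exists_global_solution
    (v := fun t (x : S) => (⟨Y t * x, hYS t x x.2⟩ : S))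
    (lipschitz_of_norm_sub_le (c := fun t => ‖Y t‖) hY.norm fun t x y => by
      change ‖Y t * (x : A) - Y t * (y : A)‖ ≤ ‖Y t‖ * ‖(x : A) - y‖
      rw [← mul_sub]
      exact norm_mul_le _ _)
    (fun _ => (hY.mul continuous_const).subtype_mk _) ⟨1, h1⟩
  refine ⟨fun t => (U t : A), by simp [hU0], fun t => ?_, fun t => (U t).2⟩
  exact (S.subtypeL.hasFDerivAt.comp_hasDerivAt t (hU t))

theorem exists_linear_solution {Y : ℝ → A} (hY : Continuous Y) :
    ∃ U : ℝ → A, U 0 = 1 ∧ ∀ t, HasDerivAt U (Y t * U t) t :=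
  exists_global_solution (v := fun t x => Y t * x) (lipschitz_mul_left hY)
    (fun _ => hY.mul continuous_const) 1

end LinearODE

/-- Bounded operators on `ℓ²(ℤ)`. -/
abbrev BddOp : Type := EllTwo →L[ℂ] EllTwo

/-- The standard unit vectors `δ_k`. -/
abbrev basisVec (k : ℤ) : EllTwo := lp.single 2 k (1 : ℂ)

theorem basisVec_apply (k n : ℤ) : basisVec k n = if n = k then 1 else 0 := by
  rw [lp.single_apply, Pi.single_apply]

/-! ### Matrix elements of bounded operators -/

section MatElem

theorem matElem_eq_apply (X : BddOp) (j k : ℤ) : matElem X j k = X (basisVec k) j := by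
  rw [matElem, lp.inner_single_left]
  simp

theorem norm_basisVec (k : ℤ) : ‖basisVec k‖ = 1 := by
  rw [lp.norm_single (by norm_num), norm_one]

theorem norm_matElem_le (X : BddOp) (j k : ℤ) : ‖matElem X j k‖ ≤ ‖X‖ := by
  rw [matElem]
  refine (norm_inner_le_norm _ _).trans ?_
  rw [norm_basisVec, one_mul]
  simpa [norm_basisVec] using X.le_opNorm (basisVec k)

@[simp] theorem matElem_add (X Y : BddOp) (j k : ℤ) :
    matElem (X + Y) j k = matElem X j k + matElem Y j k := by
  simp [matElem_eq_apply]

@[simp] theorem matElem_sub (X Y : BddOp) (j k : ℤ) :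
    matElem (X - Y) j k = matElem X j k - matElem Y j k := by
  simp [matElem_eq_apply]

@[simp] theorem matElem_neg (X : BddOp) (j k : ℤ) : matElem (-X) j k = -matElem X j k := by
  simp [matElem_eq_apply]

@[simp] theorem matElem_zero (j k : ℤ) : matElem (0 : BddOp) j k = 0 := by
  simp [matElem_eq_apply]

theorem matElem_one (j k : ℤ) : matElem (1 : BddOp) j k = if j = k then 1 else 0 := by
  rw [matElem_eq_apply, one_apply_eq_self, basisVec_apply]

@[simp] theorem matElem_smul (c : ℂ) (X : BddOp) (j k : ℤ) :
    matElem (c • X) j k = c * matElem X j k := by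
  simp [matElem_eq_apply]

@[simp] theorem matElem_real_smul (c : ℝ) (X : BddOp) (j k : ℤ) :
    matElem (c • X) j k = c * matElem X j k := by
  simp [matElem_eq_apply]

@[simp] theorem matElem_sum {ι : Type*} (s : Finset ι) (X : ι → BddOp) (j k : ℤ) :
    matElem (∑ i ∈ s, X i) j k = ∑ i ∈ s, matElem (X i) j k := by
  classical
  induction s using Finset.induction_on with
  | empty => simp
  | insert i s hi ih => rw [Finset.sum_insert hi, Finset.sum_insert hi, matElem_add, ih]

/-- The matrix element as a continuous functional. -/
def matElemL (j k : ℤ) : BddOp →L[ℝ] ℂ :=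
  LinearMap.mkContinuous
    { toFun := fun X => matElem X j k
      map_add' := fun X Y => matElem_add X Y j k
      map_smul' := fun c X => by simp } 1 fun X => by simpa using norm_matElem_le X j k

theorem continuous_matElem (j k : ℤ) : Continuous fun X => matElem X j k :=
  (matElemL j k).continuous

theorem hasDerivAt_matElem {X : ℝ → BddOp} {X' : BddOp} {t : ℝ} (h : HasDerivAt X X' t) (j k : ℤ) :
    HasDerivAt (fun s => matElem (X s) j k) (matElem X' j k) t :=
  (matElemL j k).hasFDerivAt.comp_hasDerivAt t h

/-- The coordinate of a vector as a continuous functional. -/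
def coordL (n : ℤ) : EllTwo →L[ℂ] ℂ :=
  LinearMap.mkContinuous
    { toFun := fun u => u n
      map_add' := fun _ _ => rfl
      map_smul' := fun _ _ => rfl } 1 fun u => by
        rw [one_mul]
        exact lp.norm_apply_le_norm (by norm_num) u n

@[simp] theorem coordL_apply (n : ℤ) (u : EllTwo) : coordL n u = u n := rfl

/-- Apply the continuous functional u ↦ (Xu)_j to the expansion u = ∑ u_k δ_k, which converges in
ℓ². All later row-by-row arguments rest on this. -/
theorem hasSum_matElem_mul_apply (X : BddOp) (u : EllTwo) (j : ℤ) :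
    HasSum (fun k => matElem X j k * u k) (X u j) := by
  have h := ((coordL j).comp X).hasSum (lp.hasSum_single (by norm_num : (2 : ENNReal) ≠ ⊤) u)
  convert! h using 2 with k
  have e : lp.single 2 k (u k) = u k • basisVec k := by
    rw [← lp.single_smul, smul_eq_mul, mul_one]
  simp only [ContinuousLinearMap.comp_apply]
  rw [e, map_smul, map_smul, matElem_eq_apply, smul_eq_mul, coordL_apply, mul_comm]

theorem hasSum_matElem_mul (X Y : BddOp) (j l : ℤ) :
    HasSum (fun k => matElem X j k * matElem Y k l) (matElem (X * Y) j l) := by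
  simp only [matElem_eq_apply Y, matElem_eq_apply (X * Y)]
  exact hasSum_matElem_mul_apply X (Y (basisVec l)) j

theorem ext_matElem {X Y : BddOp} (h : ∀ j k, matElem X j k = matElem Y j k) : X = Y := by
  ext u j
  have h1 := hasSum_matElem_mul_apply X u j
  simp only [h] at h1
  exact h1.unique (hasSum_matElem_mul_apply Y u j)

theorem matElem_star (X : BddOp) (j k : ℤ) :
    matElem (star X) j k = (starRingEnd ℂ) (matElem X k j) := by
  rw [matElem, matElem, ContinuousLinearMap.star_eq_adjoint,
    ContinuousLinearMap.adjoint_inner_right, inner_conj_symm]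

theorem matElem_weightedShift (w : ℤ → ℝ) (hw : ∃ C : ℝ, ∀ n, |w n| ≤ C) (m j k : ℤ) :
    matElem (weightedShift w hw m) j k = if j + m = k then (w j : ℂ) else 0 := by
  rw [matElem_eq_apply, weightedShift_apply, basisVec_apply]
  split_ifs <;> simp

theorem norm_weightedShift_le (w : ℤ → ℝ) (hw : ∃ C : ℝ, ∀ n, |w n| ≤ C) (m : ℤ) {C : ℝ}
    (hC : ∀ n, |w n| ≤ C) : ‖weightedShift w hw m‖ ≤ C := by
  have hC0 : 0 ≤ C := (abs_nonneg _).trans (hC 0)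
  refine ContinuousLinearMap.opNorm_le_bound _ hC0 fun u => ?_
  have h2 : (0 : ℝ) < (2 : ENNReal).toReal := by norm_num
  have hs := lp.hasSum_norm h2 u
  have hs' : HasSum (fun n : ℤ => (C * ‖u (n + m)‖) ^ (2 : ENNReal).toReal)
      ((C * ‖u‖) ^ (2 : ENNReal).toReal) := by
    simp only [Real.mul_rpow hC0 (norm_nonneg _)]
    exact (((Equiv.addRight m).hasSum_iff
      (f := fun n : ℤ => ‖u n‖ ^ (2 : ENNReal).toReal)).2 hs).mul_left _
  rw [← Real.rpow_le_rpow_iff (norm_nonneg _) (by positivity) h2]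
  refine hasSum_le (fun n => ?_) (lp.hasSum_norm h2 _) hs'
  rw [weightedShift_apply, norm_mul, Complex.norm_real, Real.norm_eq_abs]
  gcongr
  exact hC n

end MatElem

/-! ### Triangular operators -/

section Triangular

/-- The operators with lower triangular matrix. -/
def lowerTriangular : Submodule ℝ BddOp where
  carrier := {X | ∀ j k, j < k → matElem X j k = 0}
  zero_mem' := fun _ _ _ => matElem_zero _ _
  add_mem' := fun {X Y} hX hY j k h => by rw [matElem_add, hX j k h, hY j k h, add_zero]
  smul_mem' := fun c X hX j k h => by rw [matElem_real_smul, hX j k h, mul_zero]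

/-- The operators with upper triangular matrix. -/
def upperTriangular : Submodule ℝ BddOp where
  carrier := {X | ∀ j k, k < j → matElem X j k = 0}
  zero_mem' := fun _ _ _ => matElem_zero _ _
  add_mem' := fun {X Y} hX hY j k h => by rw [matElem_add, hX j k h, hY j k h, add_zero]
  smul_mem' := fun c X hX j k h => by rw [matElem_real_smul, hX j k h, mul_zero]

theorem isClosed_lowerTriangular : IsClosed (lowerTriangular : Set BddOp) := by
  have : (lowerTriangular : Set BddOp) = ⋂ (j) (k) (_ : j < k), {X | matElem X j k = 0} := by
    ext X; simp [lowerTriangular]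
  rw [this]
  exact isClosed_iInter fun j => isClosed_iInter fun k => isClosed_iInter fun _ =>
    isClosed_eq (continuous_matElem j k) continuous_const

theorem isClosed_upperTriangular : IsClosed (upperTriangular : Set BddOp) := by
  have : (upperTriangular : Set BddOp) = ⋂ (j) (k) (_ : k < j), {X | matElem X j k = 0} := by
    ext X; simp [upperTriangular]
  rw [this]
  exact isClosed_iInter fun j => isClosed_iInter fun k => isClosed_iInter fun _ =>
    isClosed_eq (continuous_matElem j k) continuous_const

theorem one_mem_lowerTriangular : (1 : BddOp) ∈ lowerTriangular := fun j k h => by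
  rw [matElem_one, if_neg h.ne]

theorem one_mem_upperTriangular : (1 : BddOp) ∈ upperTriangular := fun j k h => by
  rw [matElem_one, if_neg h.ne']

theorem mul_mem_lowerTriangular {X Y : BddOp} (hX : X ∈ lowerTriangular)
    (hY : Y ∈ lowerTriangular) : X * Y ∈ lowerTriangular := fun j k h => by
  refine (hasSum_matElem_mul X Y j k).unique ?_
  convert! hasSum_zero with l
  rcases lt_or_ge j l with h1 | h1
  · rw [hX j l h1, zero_mul]
  · rw [hY l k (h1.trans_lt h), mul_zero]

theorem star_mem_upperTriangular {X : BddOp} (hX : X ∈ lowerTriangular) :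
    star X ∈ upperTriangular := fun j k h => by
  rw [matElem_star, hX k j h, map_zero]

theorem star_mem_lowerTriangular {X : BddOp} (hX : X ∈ upperTriangular) :
    star X ∈ lowerTriangular := fun j k h => by
  rw [matElem_star, hX k j h, map_zero]

theorem mul_mem_upperTriangular {X Y : BddOp} (hX : X ∈ upperTriangular)
    (hY : Y ∈ upperTriangular) : X * Y ∈ upperTriangular := by
  have h := star_mem_upperTriangular
    (mul_mem_lowerTriangular (star_mem_lowerTriangular hY) (star_mem_lowerTriangular hX))
  rwa [← star_mul, star_star] at h

theorem matElem_mul_self_of_lowerTriangular {X Y : BddOp} (hX : X ∈ lowerTriangular)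
    (hY : Y ∈ lowerTriangular) (n : ℤ) :
    matElem (X * Y) n n = matElem X n n * matElem Y n n := by
  refine (hasSum_matElem_mul X Y n n).unique (hasSum_single n fun l hl => ?_)
  rcases lt_or_gt_of_ne hl with h1 | h1
  · rw [hY l n h1, mul_zero]
  · rw [hX n l h1, zero_mul]

theorem matElem_mul_self_of_upperTriangular {X Y : BddOp} (hX : X ∈ upperTriangular)
    (hY : Y ∈ upperTriangular) (n : ℤ) :
    matElem (X * Y) n n = matElem X n n * matElem Y n n := by
  refine (hasSum_matElem_mul X Y n n).unique (hasSum_single n fun l hl => ?_)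
  rcases lt_or_gt_of_ne hl with h1 | h1
  · rw [hX n l h1, zero_mul]
  · rw [hY l n h1, mul_zero]

end Triangular

/-! ### Operators with real matrix -/

section RealMatrix

/-- The operators with real matrix. -/
def realMatrix : Subalgebra ℝ BddOp where
  carrier := {X | ∀ j k, (matElem X j k).im = 0}
  mul_mem' := fun {X Y} hX hY j k => by
    have h := (Complex.hasSum_iff _ _).1 (hasSum_matElem_mul X Y j k)
    refine h.2.unique ?_
    convert! hasSum_zero with l
    rw [Complex.mul_im, hX j l, hY l k, mul_zero, zero_mul, add_zero]
  add_mem' := fun {X Y} hX hY j k => by rw [matElem_add, Complex.add_im, hX j k, hY j k, add_zero]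
  algebraMap_mem' := fun c j k => by
    rw [Algebra.algebraMap_eq_smul_one, matElem_real_smul, matElem_one]
    split_ifs <;> simp

theorem aeval_mem_of_mem {R A : Type*} [CommSemiring R] [Semiring A] [Algebra R A]
    (S : Subalgebra R A) {x : A} (hx : x ∈ S) (p : R[X]) : aeval x p ∈ S :=
  Algebra.adjoin_le (Set.singleton_subset_iff.2 hx) (aeval_mem_adjoin_singleton R x)

theorem ofReal_re_matElem {X : BddOp} (hX : X ∈ realMatrix) (j k : ℤ) :
    ((matElem X j k).re : ℂ) = matElem X j k :=
  Complex.ext rfl (hX j k).symm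

end RealMatrix

/-! ### Coefficient sequences, band operators and tridiagonal operators -/

section BoundedSequences

open BoundedContinuousFunction

/-- Bounded real two-sided sequences. -/
abbrev BddSeq : Type := BoundedContinuousFunction ℤ ℝ

theorem BddSeq.abs_le (w : BddSeq) (n : ℤ) : |w n| ≤ ‖w‖ := w.norm_coe_le_norm n

/-- The operator `(W u)_n = w_{n+c} u_{n+m}` as a function of the bounded sequence `w`. -/
def shiftWithWeight (m c : ℤ) : BddSeq →L[ℝ] BddOp :=
  LinearMap.mkContinuous
    { toFun := fun w => weightedShift (fun n => w (n + c)) ⟨‖w‖, fun n => w.abs_le (n + c)⟩ m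
      map_add' := fun v w => ext_matElem fun j k => by
        simp only [matElem_add, matElem_weightedShift]
        split_ifs <;> simp
      map_smul' := fun r w => ext_matElem fun j k => by
        simp only [matElem_real_smul, matElem_weightedShift, RingHom.id_apply]
        split_ifs <;> simp } 1
    fun w => by
      rw [one_mul]
      exact norm_weightedShift_le (fun n => w (n + c)) ⟨‖w‖, fun n => w.abs_le (n + c)⟩ m
        fun n => w.abs_le (n + c)

theorem matElem_shiftWithWeight (m c : ℤ) (w : BddSeq) (j k : ℤ) :
    matElem (shiftWithWeight m c w) j k = if j + m = k then (w (j + c) : ℂ) else 0 :=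
  matElem_weightedShift (fun n => w (n + c)) ⟨‖w‖, fun n => w.abs_le (n + c)⟩ m j k

/-- The real part of the `m`-th diagonal of the matrix of an operator. -/
def diagonalSeq (m : ℤ) : BddOp →L[ℝ] BddSeq :=
  LinearMap.mkContinuous
    { toFun := fun X => ofNormedAddCommGroupDiscrete (fun n => (matElem X n (n + m)).re) ‖X‖
        fun n => (Complex.abs_re_le_norm _).trans (norm_matElem_le X _ _)
      map_add' := fun X Y => by
        ext n
        simp
      map_smul' := fun r X => by
        ext n
        simp } 1
    fun X => by
      rw [one_mul]
      exact (norm_le (norm_nonneg _)).2 fun n =>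
        (Complex.abs_re_le_norm _).trans (norm_matElem_le X _ _)

@[simp] theorem diagonalSeq_apply (m : ℤ) (X : BddOp) (n : ℤ) :
    diagonalSeq m X n = (matElem X n (n + m)).re := rfl

/-- The antisymmetric part of a real band operator with at most `d` diagonals on either side. -/
def antisymmTruncation (d : ℕ) : BddOp →L[ℝ] BddOp :=
  ∑ m ∈ Finset.Icc (1 : ℤ) d, ((shiftWithWeight m 0).comp (diagonalSeq m)
    - (shiftWithWeight (-m) 0).comp (diagonalSeq (-m)))

/-- For matrices with at most d diagonals on either side the antisymmetric part is a finite sum over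
diagonals, each a bounded operation. The band condition thus turns X ↦ X_a into a continuous linear
map, which the ODE arguments need. -/
theorem matElem_antisymmTruncation {d : ℕ} {X : BddOp} (hX : X ∈ realMatrix)
    (hd : ∀ j k : ℤ, (d : ℤ) < |j - k| → matElem X j k = 0) (j k : ℤ) :
    matElem (antisymmTruncation d X) j k =
      if j < k then matElem X j k else if k < j then -matElem X j k else 0 := by
  have e : ∀ m : ℤ, matElem (shiftWithWeight m 0 (diagonalSeq m X)
      - shiftWithWeight (-m) 0 (diagonalSeq (-m) X)) j k
      = (if m = k - j then matElem X j k else 0) - (if m = j - k then matElem X j k else 0) := by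
    intro m
    rw [matElem_sub, matElem_shiftWithWeight, matElem_shiftWithWeight]
    congr 1
    · by_cases h : j + m = k
      · rw [if_pos h, if_pos (by omega), diagonalSeq_apply, ofReal_re_matElem hX, add_zero, h]
      · rw [if_neg h, if_neg (by omega)]
    · by_cases h : j + -m = k
      · rw [if_pos h, if_pos (by omega), diagonalSeq_apply, ofReal_re_matElem hX, add_zero, h]
      · rw [if_neg h, if_neg (by omega)]
  simp only [antisymmTruncation, _root_.sum_apply, _root_.sub_apply,
    ContinuousLinearMap.comp_apply, matElem_sum]
  simp only [e, Finset.sum_sub_distrib, Finset.sum_ite_eq', Finset.mem_Icc]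
  by_cases hjk : (d : ℤ) < |j - k|
  · simp [hd j k hjk]
  · have h := abs_le.1 (not_lt.1 hjk)
    rcases lt_trichotomy j k with h1 | h1 | h1
    · rw [if_pos (by omega), if_neg (by omega), if_pos h1, sub_zero]
    · rw [if_neg (by omega), if_neg (by omega), if_neg (by omega), if_neg (by omega), sub_zero]
    · rw [if_neg (by omega), if_pos (by omega), if_neg (by omega), if_pos h1, zero_sub]

/-- The tridiagonal operator with off-diagonal entries `x.1` and diagonal entries `x.2`. -/
def tridiagonal : BddSeq × BddSeq →L[ℝ] BddOp :=
  (shiftWithWeight 1 0 + shiftWithWeight (-1) (-1)).comp (ContinuousLinearMap.fst ℝ _ _)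
    + (shiftWithWeight 0 0).comp (ContinuousLinearMap.snd ℝ _ _)

theorem matElem_tridiagonal (x : BddSeq × BddSeq) (j k : ℤ) :
    matElem (tridiagonal x) j k = (if j + 1 = k then (x.1 j : ℂ) else 0)
      + (if j - 1 = k then (x.1 (j - 1) : ℂ) else 0) + (if j = k then (x.2 j : ℂ) else 0) := by
  change matElem (shiftWithWeight 1 0 x.1 + shiftWithWeight (-1) (-1) x.1
    + shiftWithWeight 0 0 x.2) j k = _
  simp [matElem_shiftWithWeight, sub_eq_add_neg]

theorem tridiagonal_apply (x : BddSeq × BddSeq) (u : EllTwo) (n : ℤ) :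
    tridiagonal x u n = x.1 n * u (n + 1) + x.1 (n - 1) * u (n - 1) + x.2 n * u n := by
  change (shiftWithWeight 1 0 x.1 + shiftWithWeight (-1) (-1) x.1 + shiftWithWeight 0 0 x.2) u n = _
  simp [shiftWithWeight, sub_eq_add_neg]

theorem matElem_tridiagonal_mul (x : BddSeq × BddSeq) (X : BddOp) (j k : ℤ) :
    matElem (tridiagonal x * X) j k
      = x.1 j * matElem X (j + 1) k + x.1 (j - 1) * matElem X (j - 1) k + x.2 j * matElem X j k := by
  simp only [matElem_eq_apply]
  exact tridiagonal_apply x (X (basisVec k)) j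

theorem star_tridiagonal (x : BddSeq × BddSeq) : star (tridiagonal x) = tridiagonal x := by
  refine ext_matElem fun j k => ?_
  rw [matElem_star, matElem_tridiagonal, matElem_tridiagonal]
  simp only [map_add, apply_ite (starRingEnd ℂ), Complex.conj_ofReal, map_zero]
  rcases eq_or_ne (j + 1) k with rfl | h1
  · rw [if_neg (by omega), if_pos (by omega), if_neg (by omega), if_pos rfl, if_neg (by omega),
      if_neg (by omega), add_sub_cancel_right]
    ring
  · rcases eq_or_ne (j - 1) k with rfl | h2
    · rw [if_pos (by omega), if_neg (by omega), if_neg (by omega), if_neg (by omega), if_pos rfl,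
        if_neg (by omega)]
      ring
    · rcases eq_or_ne j k with rfl | h3
      · simp
      · rw [if_neg (by omega), if_neg (by omega), if_neg (by omega), if_neg (by omega),
          if_neg (by omega), if_neg (by omega)]

theorem tridiagonal_mem_realMatrix (x : BddSeq × BddSeq) : tridiagonal x ∈ realMatrix :=
  fun j k => by
    rw [matElem_tridiagonal]
    split_ifs <;> simp

theorem matElem_mul_tridiagonal (x : BddSeq × BddSeq) (X : BddOp) (j k : ℤ) :
    matElem (X * tridiagonal x) j k
      = x.1 k * matElem X j (k + 1) + x.1 (k - 1) * matElem X j (k - 1) + x.2 k * matElem X j k := by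
  have h := matElem_tridiagonal_mul x (star X) k j
  rw [← star_tridiagonal x, ← star_mul, matElem_star] at h
  have h' := congrArg (starRingEnd ℂ) h
  simpa [matElem_star] using h'

/-- The coefficients are matrix elements. This turns conservation of the operator norm into an a
priori bound on the coefficients. -/
theorem norm_le_norm_tridiagonal (x : BddSeq × BddSeq) : ‖x‖ ≤ ‖tridiagonal x‖ := by
  refine max_le ?_ ?_
  · refine (norm_le (norm_nonneg _)).2 fun n => ?_
    have h := norm_matElem_le (tridiagonal x) n (n + 1)
    rw [matElem_tridiagonal] at h
    simpa [show ¬ (n - 1 = n + 1) by omega] using h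
  · refine (norm_le (norm_nonneg _)).2 fun n => ?_
    have h := norm_matElem_le (tridiagonal x) n n
    rw [matElem_tridiagonal] at h
    simpa using h

theorem matElem_pow_tridiagonal_eq_zero (x : BddSeq × BddSeq) (i : ℕ) :
    ∀ j k : ℤ, (i : ℤ) < |j - k| → matElem (tridiagonal x ^ i) j k = 0 := by
  induction i with
  | zero =>
    intro j k h
    rw [pow_zero, matElem_one, if_neg]
    rintro rfl
    simp at h
  | succ i ih =>
    intro j k h
    push_cast at h
    rw [pow_succ', matElem_tridiagonal_mul, ih _ _ (by grind), ih _ _ (by grind),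
      ih _ _ (by grind)]
    simp

theorem matElem_aeval_tridiagonal_eq_zero (x : BddSeq × BddSeq) (p : ℝ[X]) (j k : ℤ)
    (h : (p.natDegree : ℤ) < |j - k|) : matElem (aeval (tridiagonal x) p) j k = 0 := by
  rw [aeval_eq_sum_range, matElem_sum]
  refine Finset.sum_eq_zero fun i hi => ?_
  have : (i : ℤ) ≤ p.natDegree := by
    exact_mod_cast Nat.lt_succ_iff.1 (Finset.mem_range.1 hi)
  rw [matElem_real_smul, matElem_pow_tridiagonal_eq_zero x i j k (this.trans_lt h), mul_zero]

end BoundedSequences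

/-! ### Unitary propagators and Lax equations -/

section LinearFlows

instance : StarModule ℝ BddOp where
  star_smul c A := ext_matElem fun j k => by simp [matElem_star]

theorem eq_exp_integral_smul {E : Type*} [NormedAddCommGroup E] [NormedSpace ℝ E] {f : ℝ → E}
    {g : ℝ → ℝ} (hg : Continuous g) (hf : ∀ t, HasDerivAt f (g t • f t) t) (t : ℝ) :
    f t = Real.exp (∫ s in (0 : ℝ)..t, g s) • f 0 := by
  have hv : ∀ T : ℝ, ∃ K : NNReal, ∀ t, |t| ≤ T → LipschitzWith K (fun x : E => g t • x) :=
    lipschitz_of_norm_sub_le (c := fun t => ‖g t‖) hg.norm fun t x y => by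
      rw [← smul_sub, norm_smul]
  refine congrFun (eq_of_global_solutions hv hf (g := fun t =>
    Real.exp (∫ s in (0 : ℝ)..t, g s) • f 0) (fun t => ?_) (by simp)) t
  have h1 := (hg.integral_hasStrictDerivAt 0 t).hasDerivAt.exp.smul_const (f 0)
  convert! h1 using 1
  rw [smul_smul, mul_comm]

variable {Y : ℝ → BddOp}

theorem exists_unitary_solution (hY : Continuous Y) (hs : ∀ t, star (Y t) = -Y t) :
    ∃ U : ℝ → BddOp, U 0 = 1 ∧ (∀ t, HasDerivAt U (Y t * U t) t) ∧
      ∀ t, U t ∈ unitary BddOp := by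
  obtain ⟨U, hU0, hU⟩ := exists_linear_solution hY
  have hUs : ∀ t, HasDerivAt (fun s => star (U s)) (-(star (U t) * Y t)) t := fun t => by
    have h := (hU t).star
    rwa [star_mul, hs, mul_neg] at h
  refine ⟨U, hU0, hU, fun t => Unitary.mem_iff.2 ⟨?_, ?_⟩⟩
  · have h : ∀ t, HasDerivAt (fun s => star (U s) * U s) 0 t := fun t => by
      convert! (hUs t).mul (hU t) using 1
      noncomm_ring
    have h' := is_const_of_deriv_eq_zero (fun t => (h t).differentiableAt) (fun t => (h t).deriv) t 0
    simpa [hU0] using h'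
  -- In infinite dimensions U U* = 1 does not follow from U* U = 1. Here U U* and the constant 1
  -- solve the same commutator equation with the same initial value.
  · refine congrFun (eq_of_global_solutions (lipschitz_commutator hY)
      (f := fun s => U s * star (U s)) (g := fun _ => 1) (fun t => ?_) (fun t => ?_) (by simp [hU0])) t
    · convert! (hU t).mul (hUs t) using 1
      noncomm_ring
    · simpa using hasDerivAt_const t (1 : BddOp)

/-- With Y regarded as given, the Lax equation is linear in C; the conjugated curve solves it too,
and uniqueness applies. -/
theorem lax_eq_conj (hY : Continuous Y) (hs : ∀ t, star (Y t) = -Y t) {U : ℝ → BddOp}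
    (hU0 : U 0 = 1) (hU : ∀ t, HasDerivAt U (Y t * U t) t)
    {C : ℝ → BddOp} (hC : ∀ t, HasDerivAt C (Y t * C t - C t * Y t) t) (t : ℝ) :
    C t = U t * C 0 * star (U t) := by
  refine congrFun (eq_of_global_solutions (lipschitz_commutator hY) hC
    (g := fun t => U t * C 0 * star (U t)) (fun t => ?_) (by simp [hU0])) t
  have hUs : HasDerivAt (fun s => star (U s)) (-(star (U t) * Y t)) t := by
    have h := (hU t).star
    rwa [star_mul, hs, mul_neg] at h
  convert! ((hU t).mul_const (C 0)).mul hUs using 1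
  noncomm_ring

theorem norm_unitary_conj_le {U : BddOp} (hU : U ∈ unitary BddOp) (A : BddOp) :
    ‖U * A * star U‖ ≤ ‖A‖ := by
  rw [CStarRing.norm_mul_mem_unitary _ (Unitary.star_mem hU), CStarRing.norm_mem_unitary_mul _ hU]

end LinearFlows

/-! ### Maps that are Lipschitz on bounded sets -/

section LipschitzOnBounded

variable {E F : Type*} [NormedAddCommGroup E] [NormedAddCommGroup F]

/-- Maps that are bounded and Lipschitz on every ball around the origin. -/
def LipschitzOnBounded (f : E → F) : Prop :=
  ∀ R : ℝ, ∃ K : ℝ, 0 ≤ K ∧ (∀ x, ‖x‖ ≤ R → ‖f x‖ ≤ K) ∧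
    ∀ x y, ‖x‖ ≤ R → ‖y‖ ≤ R → ‖f x - f y‖ ≤ K * ‖x - y‖

namespace LipschitzOnBounded

theorem const (c : F) : LipschitzOnBounded fun _ : E => c := fun _ =>
  ⟨‖c‖, norm_nonneg _, fun _ _ => le_rfl, fun x y _ _ => by
    rw [sub_self, norm_zero]; positivity⟩

theorem sub {f g : E → F} (hf : LipschitzOnBounded f) (hg : LipschitzOnBounded g) :
    LipschitzOnBounded fun x => f x - g x := fun R => by
  obtain ⟨K, hK, hf1, hf2⟩ := hf R
  obtain ⟨L, hL, hg1, hg2⟩ := hg R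
  refine ⟨K + L, by positivity, fun x hx => (norm_sub_le _ _).trans (add_le_add (hf1 x hx)
    (hg1 x hx)), fun x y hx hy => ?_⟩
  rw [sub_sub_sub_comm, add_mul]
  exact (norm_sub_le _ _).trans (add_le_add (hf2 x y hx hy) (hg2 x y hx hy))

theorem add {f g : E → F} (hf : LipschitzOnBounded f) (hg : LipschitzOnBounded g) :
    LipschitzOnBounded fun x => f x + g x := fun R => by
  obtain ⟨K, hK, hf1, hf2⟩ := hf R
  obtain ⟨L, hL, hg1, hg2⟩ := hg R
  refine ⟨K + L, by positivity, fun x hx => (norm_add_le _ _).trans (add_le_add (hf1 x hx)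
    (hg1 x hx)), fun x y hx hy => ?_⟩
  rw [add_sub_add_comm, add_mul]
  exact (norm_add_le _ _).trans (add_le_add (hf2 x y hx hy) (hg2 x y hx hy))

theorem mul {A : Type*} [NormedRing A] {f g : E → A} (hf : LipschitzOnBounded f)
    (hg : LipschitzOnBounded g) : LipschitzOnBounded fun x => f x * g x := fun R => by
  obtain ⟨K, hK, hf1, hf2⟩ := hf R
  obtain ⟨L, hL, hg1, hg2⟩ := hg R
  have h1 : ∀ x, ‖x‖ ≤ R → ‖f x * g x‖ ≤ K * L := fun x hx =>
    (norm_mul_le _ _).trans (mul_le_mul (hf1 x hx) (hg1 x hx) (norm_nonneg _) hK)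
  refine ⟨2 * (K * L), by positivity, fun x hx => (h1 x hx).trans
    (by linarith [mul_nonneg hK hL]), fun x y hx hy => ?_⟩
  have e : f x * g x - f y * g y = f x * (g x - g y) + (f x - f y) * g y := by noncomm_ring
  rw [e]
  calc ‖f x * (g x - g y) + (f x - f y) * g y‖
      ≤ ‖f x‖ * ‖g x - g y‖ + ‖f x - f y‖ * ‖g y‖ :=
        (norm_add_le _ _).trans (add_le_add (norm_mul_le _ _) (norm_mul_le _ _))
    _ ≤ K * (L * ‖x - y‖) + (K * ‖x - y‖) * L := by
        gcongr
        · exact hf1 x hx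
        · exact hg2 x y hx hy
        · exact hf2 x y hx hy
        · exact hg1 y hy
    _ = 2 * (K * L) * ‖x - y‖ := by ring

theorem clm_comp {G : Type*} [NormedAddCommGroup G] [NormedSpace ℝ F] [NormedSpace ℝ G]
    (L : F →L[ℝ] G) {f : E → F} (hf : LipschitzOnBounded f) :
    LipschitzOnBounded fun x => L (f x) := fun R => by
  obtain ⟨K, hK, hf1, hf2⟩ := hf R
  refine ⟨‖L‖ * K, by positivity, fun x hx => (L.le_opNorm _).trans ?_, fun x y hx hy => ?_⟩
  · gcongr
    exact hf1 x hx
  · rw [← map_sub, mul_assoc]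
    refine (L.le_opNorm _).trans ?_
    gcongr
    exact hf2 x y hx hy

theorem clm [NormedSpace ℝ E] [NormedSpace ℝ F] (L : E →L[ℝ] F) : LipschitzOnBounded L :=
  clm_comp L (f := fun x => x) fun R => ⟨max R 1, le_max_of_le_right zero_le_one,
    fun _ hx => hx.trans (le_max_left _ _), fun _ _ _ _ =>
      le_mul_of_one_le_left (norm_nonneg _) (le_max_right _ _)⟩

theorem prodMk {G : Type*} [NormedAddCommGroup G] {f : E → F} {g : E → G}
    (hf : LipschitzOnBounded f) (hg : LipschitzOnBounded g) :
    LipschitzOnBounded fun x => (f x, g x) := fun R => by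
  obtain ⟨K, hK, hf1, hf2⟩ := hf R
  obtain ⟨L, hL, hg1, hg2⟩ := hg R
  refine ⟨max K L, le_max_of_le_left hK, fun x hx => max_le_max (hf1 x hx) (hg1 x hx),
    fun x y hx hy => max_le ?_ ?_⟩
  · refine (hf2 x y hx hy).trans ?_
    gcongr
    exact le_max_left _ _
  · refine (hg2 x y hx hy).trans ?_
    gcongr
    exact le_max_right _ _

theorem aeval {f : E → BddOp} (hf : LipschitzOnBounded f) (p : ℝ[X]) :
    LipschitzOnBounded fun x => aeval (f x) p := by
  induction p using Polynomial.induction_on with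
  | C a => simpa only [aeval_C] using const _
  | add p q hp hq => simpa only [map_add] using hp.add hq
  | monomial n a ih =>
    simp only [pow_succ, ← mul_assoc]
    rw [show (fun x => Polynomial.aeval (f x) (C a * X ^ n * X))
      = fun x => Polynomial.aeval (f x) (C a * X ^ n) * f x by
        funext x; rw [map_mul _ _ X, aeval_X]]
    exact ih.mul hf

theorem exists_lipschitzWith_comp_radialRetraction [NormedSpace ℝ E] {f : E → F}
    (hf : LipschitzOnBounded f) {R : ℝ} (hR : 0 < R) :
    ∃ K : NNReal, LipschitzWith K fun x => f (radialRetraction R x) := by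
  obtain ⟨K, hK, -, h⟩ := hf R
  have hK' : LipschitzOnWith ⟨K, hK⟩ f (Metric.closedBall 0 R) :=
    LipschitzOnWith.of_dist_le_mul fun x hx y hy => by
      rw [dist_eq_norm, dist_eq_norm]
      exact h x y (mem_closedBall_zero_iff.1 hx) (mem_closedBall_zero_iff.1 hy)
  refine ⟨⟨K, hK⟩ * 2, ?_⟩
  rw [← lipschitzOnWith_univ]
  exact hK'.comp (lipschitzWith_radialRetraction hR).lipschitzOnWith fun x _ =>
    mem_closedBall_zero_iff.2 (norm_radialRetraction_le hR x)

end LipschitzOnBounded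

end LipschitzOnBounded

/-! ### The Toda vector field on coefficient sequences -/

section TodaField

theorem star_aeval (A : BddOp) (p : ℝ[X]) : star (aeval A p) = aeval (star A) p := by
  simp only [aeval_eq_sum_range, star_sum, star_smul, star_pow, star_trivial]

theorem aeval_tridiagonal_mem_realMatrix (x : BddSeq × BddSeq) (p : ℝ[X]) :
    aeval (tridiagonal x) p ∈ realMatrix :=
  aeval_mem_of_mem _ (tridiagonal_mem_realMatrix x) p

theorem matElem_aeval_tridiagonal_comm (x : BddSeq × BddSeq) (p : ℝ[X]) (j k : ℤ) :
    matElem (aeval (tridiagonal x) p) j k = matElem (aeval (tridiagonal x) p) k j := by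
  conv_lhs => rw [← star_tridiagonal x, ← star_aeval, matElem_star,
    ← ofReal_re_matElem (aeval_tridiagonal_mem_realMatrix x p), Complex.conj_ofReal,
    ofReal_re_matElem (aeval_tridiagonal_mem_realMatrix x p)]

/-- The antisymmetric part of `p` of a tridiagonal operator. -/
def todaLax (p : ℝ[X]) (x : BddSeq × BddSeq) : BddOp :=
  antisymmTruncation p.natDegree (aeval (tridiagonal x) p)

theorem matElem_todaLax (p : ℝ[X]) (x : BddSeq × BddSeq) (j k : ℤ) :
    matElem (todaLax p x) j k =
      if j < k then matElem (aeval (tridiagonal x) p) j k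
      else if k < j then -matElem (aeval (tridiagonal x) p) j k else 0 :=
  matElem_antisymmTruncation (aeval_tridiagonal_mem_realMatrix x p)
    (matElem_aeval_tridiagonal_eq_zero x p) j k

theorem star_todaLax (p : ℝ[X]) (x : BddSeq × BddSeq) : star (todaLax p x) = -todaLax p x := by
  refine ext_matElem fun j k => ?_
  rw [matElem_star, matElem_neg, matElem_todaLax, matElem_todaLax,
    matElem_aeval_tridiagonal_comm x p k j,
    ← ofReal_re_matElem (aeval_tridiagonal_mem_realMatrix x p) j k]
  rcases lt_trichotomy j k with h | h | h
  · simp [h, h.not_gt]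
  · simp [h]
  · simp [h, h.not_gt]

/-- The right-hand side of the Lax equation. -/
def todaCommutator (p : ℝ[X]) (x : BddSeq × BddSeq) : BddOp :=
  todaLax p x * tridiagonal x - tridiagonal x * todaLax p x

/-- The vector field of the Toda flow on the coefficients. -/
def todaField (p : ℝ[X]) (x : BddSeq × BddSeq) : BddSeq × BddSeq :=
  (diagonalSeq 1 (todaCommutator p x), diagonalSeq 0 (todaCommutator p x))

theorem matElem_commutator_aeval (p : ℝ[X]) (x : BddSeq × BddSeq) (j k : ℤ) :
    matElem (aeval (tridiagonal x) p * tridiagonal x) j k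
      = matElem (tridiagonal x * aeval (tridiagonal x) p) j k := by
  have h : aeval (tridiagonal x) p * tridiagonal x = tridiagonal x * aeval (tridiagonal x) p := by
    have h1 := congrArg (aeval (tridiagonal x)) (mul_comm p X)
    rwa [map_mul, map_mul, aeval_X] at h1
  rw [h]

theorem star_todaCommutator (p : ℝ[X]) (x : BddSeq × BddSeq) :
    star (todaCommutator p x) = todaCommutator p x := by
  rw [todaCommutator, star_sub, star_mul, star_mul, star_todaLax, star_tridiagonal]
  noncomm_ring

/-- This far above the diagonal, only strictly upper entries of p(J)_a enter; they equal those of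
p(J), which commutes with J. -/
theorem matElem_todaCommutator_of_lt (p : ℝ[X]) (x : BddSeq × BddSeq) {j k : ℤ} (h : j + 1 < k) :
    matElem (todaCommutator p x) j k = 0 := by
  have h1 := matElem_commutator_aeval p x j k
  rw [matElem_mul_tridiagonal, matElem_tridiagonal_mul] at h1
  rw [todaCommutator, matElem_sub, matElem_mul_tridiagonal, matElem_tridiagonal_mul]
  simp only [matElem_todaLax]
  rw [if_pos (by omega), if_pos (by omega), if_pos (by omega), if_pos (by omega),
    if_pos (by omega), h1, sub_self]

/-- Compare with [p(J), J] = 0: the two commutators differ at this position only through the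
diagonal entries of p(J), which p(J)_a lacks. The resulting proportionality to a_n is what keeps a_n
positive. -/
theorem matElem_todaCommutator_succ (p : ℝ[X]) (x : BddSeq × BddSeq) (n : ℤ) :
    matElem (todaCommutator p x) n (n + 1) = x.1 n *
      (matElem (aeval (tridiagonal x) p) (n + 1) (n + 1) - matElem (aeval (tridiagonal x) p) n n) := by
  have h1 := matElem_commutator_aeval p x n (n + 1)
  rw [matElem_mul_tridiagonal, matElem_tridiagonal_mul] at h1
  rw [todaCommutator, matElem_sub, matElem_mul_tridiagonal, matElem_tridiagonal_mul]
  simp only [matElem_todaLax]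
  rw [if_pos (by omega), if_neg (by omega), if_neg (by omega), if_pos (by omega),
    if_neg (by omega), if_neg (by omega), if_pos (by omega)]
  rw [add_sub_cancel_right] at h1 ⊢
  linear_combination h1

theorem todaCommutator_mem_realMatrix (p : ℝ[X]) (x : BddSeq × BddSeq) :
    todaCommutator p x ∈ realMatrix := by
  have h1 := tridiagonal_mem_realMatrix x
  have h2 : todaLax p x ∈ realMatrix := fun j k => by
    have := aeval_tridiagonal_mem_realMatrix x p j k
    rw [matElem_todaLax]
    split_ifs <;> simp [this]
  exact sub_mem (mul_mem h2 h1) (mul_mem h1 h2)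

/-- The commutator is real and self-adjoint, hence symmetric, and vanishes above the first
off-diagonal, so it is tridiagonal. The Lax equation is therefore an ODE for the coefficients alone.
-/
theorem tridiagonal_todaField (p : ℝ[X]) (x : BddSeq × BddSeq) :
    tridiagonal (todaField p x) = todaCommutator p x := by
  have hr := todaCommutator_mem_realMatrix p x
  have hsymm : ∀ j k, matElem (todaCommutator p x) j k = matElem (todaCommutator p x) k j :=
    fun j k => by
    rw [← ofReal_re_matElem hr k j, ← Complex.conj_ofReal, ofReal_re_matElem hr, ← matElem_star,
      star_todaCommutator]
  refine ext_matElem fun j k => ?_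
  rw [matElem_tridiagonal]
  simp only [todaField, diagonalSeq_apply, ofReal_re_matElem hr, sub_add_cancel, add_zero]
  rcases lt_trichotomy (j + 1) k with h | h | h
  · rw [if_neg (by omega), if_neg (by omega), if_neg (by omega),
      matElem_todaCommutator_of_lt p x h]
    simp
  · subst h
    rw [if_pos rfl, if_neg (by omega), if_neg (by omega)]
    simp
  · rcases lt_trichotomy j k with h1 | h1 | h1
    · omega
    · subst h1
      rw [if_neg (by omega), if_neg (by omega), if_pos rfl]
      simp
    · rcases eq_or_ne (j - 1) k with h2 | h2
      · subst h2
        rw [if_neg (by omega), if_pos rfl, if_neg (by omega), hsymm]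
        simp
      · rw [if_neg (by omega), if_neg (by omega), if_neg (by omega), hsymm,
          matElem_todaCommutator_of_lt p x (by omega)]
        simp

theorem lipschitzOnBounded_todaLax (p : ℝ[X]) : LipschitzOnBounded (todaLax p) :=
  ((LipschitzOnBounded.clm tridiagonal).aeval p).clm_comp (antisymmTruncation p.natDegree)

theorem lipschitzOnBounded_todaField (p : ℝ[X]) : LipschitzOnBounded (todaField p) := by
  have h1 := lipschitzOnBounded_todaLax p
  have h2 := LipschitzOnBounded.clm tridiagonal
  have h3 := (h1.mul h2).sub (h2.mul h1)
  exact (h3.clm_comp (diagonalSeq 1)).prodMk (h3.clm_comp (diagonalSeq 0))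

theorem continuous_todaLax (p : ℝ[X]) : Continuous (todaLax p) :=
  (antisymmTruncation p.natDegree).continuous.comp
    ((Polynomial.continuous_aeval p).comp tridiagonal.continuous)

/-- Cut the field off by the radial retraction, solve globally, and show that the cutoff is
inactive: even the cut-off equation has Lax form, so the operator norm is conserved. -/
theorem exists_todaField_solution (p : ℝ[X]) (x₀ : BddSeq × BddSeq) :
    ∃ x : ℝ → BddSeq × BddSeq, x 0 = x₀ ∧ ∀ t, HasDerivAt x (todaField p (x t)) t := by
  set R : ℝ := ‖tridiagonal x₀‖ + 1 with hRdef
  have hR : 0 < R := by positivity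
  obtain ⟨K, hK⟩ :=
    (lipschitzOnBounded_todaField p).exists_lipschitzWith_comp_radialRetraction hR
  obtain ⟨x, hx0, hx⟩ := exists_global_solution
    (v := fun _ x => todaField p (radialRetraction R x)) (fun _ => ⟨K, fun _ _ => hK⟩)
    (fun _ => continuous_const) x₀
  refine ⟨x, hx0, fun t => ?_⟩
  have hxc : Continuous x := continuous_iff_continuousAt.2 fun t => (hx t).continuousAt
  have hm : ∀ t, max R ‖x t‖ ≠ 0 := fun t => (lt_max_of_lt_left hR).ne'
  -- The retraction multiplies x by a scalar and `tridiagonal` is linear, so this scalar can be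
  -- moved from J to the other factor of the commutator. The result is still skew-adjoint.
  let Y : ℝ → BddOp := fun t => (R / max R ‖x t‖) • todaLax p (radialRetraction R (x t))
  have hYc : Continuous Y := by
    refine (continuous_const.div (continuous_const.max hxc.norm) hm).smul
      ((continuous_todaLax p).comp ?_)
    exact (lipschitzWith_radialRetraction hR).continuous.comp hxc
  have hYs : ∀ t, star (Y t) = -Y t := fun t => by
    simp only [Y, star_smul, star_todaLax, star_trivial, smul_neg]
  obtain ⟨U, hU0, hU, hUu⟩ := exists_unitary_solution hYc hYs
  have hL : ∀ t, HasDerivAt (fun s => tridiagonal (x s))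
      (Y t * tridiagonal (x t) - tridiagonal (x t) * Y t) t := fun t => by
    have h := tridiagonal.hasFDerivAt.comp_hasDerivAt t (hx t)
    rw [tridiagonal_todaField, todaCommutator] at h
    convert! h using 1
    simp only [Y]
    rw [show tridiagonal (radialRetraction R (x t)) = (R / max R ‖x t‖) • tridiagonal (x t) from
      map_smul _ _ _]
    simp only [smul_mul_assoc, mul_smul_comm]
  have hn : ‖x t‖ ≤ R := by
    refine (norm_le_norm_tridiagonal (x t)).trans ?_
    rw [lax_eq_conj hYc hYs hU0 hU hL t, hx0]
    refine (norm_unitary_conj_le (hUu t) _).trans ?_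
    rw [hRdef]; linarith
  have := hx t
  rwa [radialRetraction_of_norm_le hR hn] at this

end TodaField

/-! ### Jacobi matrices, their coefficients, and existence of Toda flows -/

namespace JacobiMatrix

/-- The pair of coefficient sequences of a Jacobi matrix. -/
def coeffs (J : JacobiMatrix) : BddSeq × BddSeq :=
  (BoundedContinuousFunction.ofNormedAddCommGroupDiscrete J.a J.a_bdd.choose J.a_bdd.choose_spec,
    BoundedContinuousFunction.ofNormedAddCommGroupDiscrete J.b J.b_bdd.choose J.b_bdd.choose_spec)

@[simp] theorem coeffs_fst_apply (J : JacobiMatrix) (n : ℤ) : J.coeffs.1 n = J.a n := rfl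

@[simp] theorem coeffs_snd_apply (J : JacobiMatrix) (n : ℤ) : J.coeffs.2 n = J.b n := rfl

/-- The Jacobi matrix with given coefficient sequences. -/
def ofCoeffs (x : BddSeq × BddSeq) (h : ∀ n, 0 < x.1 n) : JacobiMatrix where
  a := x.1
  b := x.2
  a_pos := h
  a_bdd := ⟨‖x.1‖, x.1.abs_le⟩
  b_bdd := ⟨‖x.2‖, x.2.abs_le⟩

theorem tridiagonal_coeffs (J : JacobiMatrix) : tridiagonal J.coeffs = J.toOp := by
  ext u n
  rw [tridiagonal_apply, toOp_apply]
  rfl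

theorem toOp_ofCoeffs (x : BddSeq × BddSeq) (h : ∀ n, 0 < x.1 n) :
    (ofCoeffs x h).toOp = tridiagonal x := by
  ext u n
  rw [tridiagonal_apply, toOp_apply]
  rfl

theorem matElem_toOp_succ (J : JacobiMatrix) (n : ℤ) : matElem J.toOp n (n + 1) = J.a n := by
  rw [← tridiagonal_coeffs, matElem_tridiagonal, if_pos rfl, if_neg (by omega), if_neg (by omega)]
  simp

theorem matElem_toOp_self (J : JacobiMatrix) (n : ℤ) : matElem J.toOp n n = J.b n := by
  rw [← tridiagonal_coeffs, matElem_tridiagonal, if_neg (by omega), if_neg (by omega), if_pos rfl]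
  simp

theorem toOp_injective : Function.Injective toOp := fun J K h => by
  ext n
  · rw [← Complex.ofReal_inj, ← matElem_toOp_succ, h, matElem_toOp_succ]
  · rw [← Complex.ofReal_inj, ← matElem_toOp_self, h, matElem_toOp_self]

end JacobiMatrix

theorem isAntisymmPart_todaLax (p : ℝ[X]) (J : JacobiMatrix) :
    IsAntisymmPart (aeval J.toOp p) (todaLax p J.coeffs) := fun j k => by
  rw [matElem_todaLax, J.tridiagonal_coeffs]

theorem IsAntisymmPart.unique {X Y Z : BddOp} (hY : IsAntisymmPart X Y) (hZ : IsAntisymmPart X Z) :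
    Y = Z :=
  ext_matElem fun j k => (hY j k).trans (hZ j k).symm

/-- What remains beyond solving for the coefficients is positivity: each a_n satisfies a scalar
linear equation, so it is its initial value times an exponential. -/
theorem exists_isTodaFlow (p : ℝ[X]) (J : JacobiMatrix) :
    ∃ γ : ℝ → JacobiMatrix, IsTodaFlow p J γ := by
  obtain ⟨x, hx0, hx⟩ := exists_todaField_solution p J.coeffs
  have hxc : Continuous x := continuous_iff_continuousAt.2 fun t => (hx t).continuousAt
  have hpos : ∀ t n, 0 < (x t).1 n := fun t n => by
    have hd : ∀ t, HasDerivAt (fun s => (x s).1 n)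
        (((matElem (aeval (tridiagonal (x t)) p) (n + 1) (n + 1)).re
          - (matElem (aeval (tridiagonal (x t)) p) n n).re) • (x t).1 n) t := fun t => by
      have h1 := ((BoundedContinuousFunction.evalCLM ℝ n).comp
        (ContinuousLinearMap.fst ℝ BddSeq BddSeq)).hasFDerivAt.comp_hasDerivAt t (hx t)
      convert! h1 using 1
      change _ = (matElem (todaCommutator p (x t)) n (n + 1)).re
      rw [matElem_todaCommutator_succ, Complex.re_ofReal_mul, Complex.sub_re, smul_eq_mul, mul_comm]
    have hXc : ∀ k, Continuous fun t => (matElem (aeval (tridiagonal (x t)) p) k k).re := fun k =>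
      Complex.continuous_re.comp ((continuous_matElem k k).comp
        ((Polynomial.continuous_aeval p).comp (tridiagonal.continuous.comp hxc)))
    rw [eq_exp_integral_smul ((hXc (n + 1)).sub (hXc n)) hd t, hx0]
    exact mul_pos (Real.exp_pos _) (J.a_pos n)
  refine ⟨fun t => JacobiMatrix.ofCoeffs (x t) (hpos t), ?_, fun t => ?_⟩
  · refine JacobiMatrix.toOp_injective ?_
    rw [JacobiMatrix.toOp_ofCoeffs, hx0, J.tridiagonal_coeffs]
  · refine ⟨_, isAntisymmPart_todaLax p _, ?_⟩
    have h := tridiagonal.hasFDerivAt.comp_hasDerivAt t (hx t)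
    rw [tridiagonal_todaField, todaCommutator] at h
    simpa only [JacobiMatrix.toOp_ofCoeffs] using! h

/-! ### Exponentials, polynomials and unitary conjugation -/

section Exponential

open NormedSpace

theorem expOp_add {X Z : BddOp} (h : Commute X Z) : exp (X + Z) = exp X * exp Z := by
  let _ : NormedAlgebra ℚ BddOp := NormedAlgebra.restrictScalars ℚ ℂ BddOp
  exact exp_add_of_commute h

theorem expOp_mul_expOp_neg (X : BddOp) : exp X * exp (-X) = 1 := by
  rw [← expOp_add (Commute.refl X).neg_right, add_neg_cancel, exp_zero]

theorem expOp_neg_mul_expOp (X : BddOp) : exp (-X) * exp X = 1 := by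
  rw [← expOp_add (Commute.refl X).neg_left, neg_add_cancel, exp_zero]

theorem expOp_unitary_conj {U : BddOp} (hU : U ∈ unitary BddOp) (X : BddOp) :
    exp (U * X * star U) = U * exp X * star U := by
  let _ : NormedAlgebra ℚ BddOp := NormedAlgebra.restrictScalars ℚ ℂ BddOp
  exact exp_units_conj (Unitary.toUnits ⟨U, hU⟩) X

theorem aeval_unitary_conj {U : BddOp} (hU : U ∈ unitary BddOp) (A : BddOp) (p : ℝ[X]) :
    aeval (U * A * star U) p = U * aeval A p * star U := by
  induction p using Polynomial.induction_on with
  | C a =>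
    rw [aeval_C, aeval_C, Algebra.algebraMap_eq_smul_one, mul_smul_comm, smul_mul_assoc, mul_one,
      Unitary.mul_star_self_of_mem hU]
  | add p q hp hq => rw [map_add, map_add, hp, hq, mul_add, add_mul]
  | monomial n a ih =>
    rw [pow_succ, ← mul_assoc, map_mul _ _ X, map_mul _ _ X, ih, aeval_X, aeval_X]
    calc U * aeval A (C a * X ^ n) * star U * (U * A * star U)
        = U * aeval A (C a * X ^ n) * (star U * U) * A * star U := by noncomm_ring
      _ = U * (aeval A (C a * X ^ n) * A) * star U := by
        rw [Unitary.star_mul_self_of_mem hU]; noncomm_ring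

end Exponential

/-! ### The triangular factorization of exp X and its uniqueness -/

section Dressing

open NormedSpace
open scoped ComplexOrder

/-- `U` is the unitary factor in the factorization of `exp X`, for self-adjoint `X`, into a lower
triangular operator with positive diagonal and lower triangular inverse, and a unitary one. -/
structure IsDressing (X U : BddOp) : Prop where
  mem_unitary : U ∈ unitary BddOp
  lower : U * exp (-X) ∈ lowerTriangular
  upper : U * exp X ∈ upperTriangular
  lower_pos : ∀ n, 0 < matElem (U * exp (-X)) n n
  upper_pos : ∀ n, 0 < matElem (U * exp X) n n

namespace IsDressing

theorem zero : IsDressing 0 1 where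
  mem_unitary := one_mem _
  lower := by simpa using one_mem_lowerTriangular
  upper := by simpa using one_mem_upperTriangular
  lower_pos := by simp [matElem_one]
  upper_pos := by simp [matElem_one]

/-- Inserting exp(-X) exp(X) between U and V* makes U V* lower triangular; inserting exp(X) exp(-X)
makes it upper triangular. A diagonal unitary with positive entries is the identity. -/
theorem unique {X U V : BddOp} (hX : star X = X) (hU : IsDressing X U) (hV : IsDressing X V) :
    U = V := by
  have h1 : U * star V = U * exp (-X) * star (V * exp X) := by
    rw [star_mul, star_exp, hX]
    calc U * star V = U * (exp (-X) * exp X) * star V := by rw [expOp_neg_mul_expOp, mul_one]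
      _ = _ := by noncomm_ring
  have h2 : U * star V = U * exp X * star (V * exp (-X)) := by
    rw [star_mul, star_exp, star_neg, hX]
    calc U * star V = U * (exp X * exp (-X)) * star V := by rw [expOp_mul_expOp_neg, mul_one]
      _ = _ := by noncomm_ring
  have hl : U * star V ∈ lowerTriangular := by
    rw [h1]; exact mul_mem_lowerTriangular hU.lower (star_mem_lowerTriangular hV.upper)
  have hu : U * star V ∈ upperTriangular := by
    rw [h2]; exact mul_mem_upperTriangular hU.upper (star_mem_upperTriangular hV.lower)
  have hpos : ∀ n, 0 < matElem (U * star V) n n := fun n => by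
    rw [h1, matElem_mul_self_of_lowerTriangular hU.lower (star_mem_lowerTriangular hV.upper),
      matElem_star]
    have h3 := hV.upper_pos n
    rw [Complex.conj_eq_iff_im.2 (Complex.pos_iff.1 h3).2.symm]
    exact mul_pos (hU.lower_pos n) h3
  have hdu : U * star V ∈ unitary BddOp := mul_mem hU.mem_unitary (Unitary.star_mem hV.mem_unitary)
  have hone : ∀ n, matElem (U * star V) n n = 1 := fun n => by
    have h3 := matElem_mul_self_of_lowerTriangular hl (star_mem_lowerTriangular hu) n
    rw [Unitary.mul_star_self_of_mem hdu, matElem_one, if_pos rfl, matElem_star] at h3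
    obtain ⟨h4, h5⟩ := Complex.pos_iff.1 (hpos n)
    rw [Complex.conj_eq_iff_im.2 h5.symm] at h3
    rcases mul_self_eq_one_iff.1 h3.symm with h6 | h6
    · exact h6
    · rw [h6] at h4; norm_num at h4
  have hD : U * star V = 1 := ext_matElem fun j k => by
    rw [matElem_one]
    rcases lt_trichotomy j k with h | h | h
    · rw [hl j k h, if_neg h.ne]
    · rw [h, hone, if_pos rfl]
    · rw [hu j k h, if_neg h.ne']
  calc U = U * (star V * V) := by rw [Unitary.star_mul_self_of_mem hV.mem_unitary, mul_one]
    _ = V := by rw [← mul_assoc, hD, one_mul]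

theorem conj_aux {U V X Z : BddOp} (hU : U ∈ unitary BddOp) (h : Commute X Z) :
    V * U * exp (X + Z) = V * exp (U * Z * star U) * (U * exp X) := by
  rw [expOp_unitary_conj hU, add_comm, expOp_add h.symm]
  calc V * U * (exp Z * exp X) = V * (U * exp Z * 1 * exp X) := by noncomm_ring
    _ = _ := by rw [← Unitary.star_mul_self_of_mem hU]; noncomm_ring

/-- By commutativity and U exp(Z) = exp(U Z U*) U, the operator V U exp(±(X + Z)) is the product of
the triangular operators belonging to V and to U; diagonals of triangular products multiply. -/
theorem mul {X Z U V : BddOp} (hU : IsDressing X U) (hV : IsDressing (U * Z * star U) V)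
    (h : Commute X Z) : IsDressing (X + Z) (V * U) := by
  have h1 := conj_aux (V := V) hU.mem_unitary h
  have h2 : V * U * exp (-(X + Z)) = V * exp (-(U * Z * star U)) * (U * exp (-X)) := by
    rw [neg_add, conj_aux hU.mem_unitary h.neg_left.neg_right]
    simp only [mul_neg, neg_mul]
  refine ⟨mul_mem hV.mem_unitary hU.mem_unitary, ?_, ?_, fun n => ?_, fun n => ?_⟩
  · rw [h2]; exact mul_mem_lowerTriangular hV.lower hU.lower
  · rw [h1]; exact mul_mem_upperTriangular hV.upper hU.upper
  · rw [h2, matElem_mul_self_of_lowerTriangular hV.lower hU.lower]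
    exact mul_pos (hV.lower_pos n) (hU.lower_pos n)
  · rw [h1, matElem_mul_self_of_upperTriangular hV.upper hU.upper]
    exact mul_pos (hV.upper_pos n) (hU.upper_pos n)

end IsDressing

/-- The translation `(u_k) ↦ (u_{k+n})` of `ℓ²(ℤ)`. -/
def translation (n : ℤ) : BddOp := weightedShift (fun _ => 1) ⟨1, fun _ => by simp⟩ n

@[simp] theorem translation_apply (n : ℤ) (u : EllTwo) (k : ℤ) :
    translation n u k = u (k + n) := by
  simp [translation]

theorem star_translation (n : ℤ) : star (translation n) = translation (-n) :=
  ext_matElem fun j k => by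
    rw [matElem_star, translation, translation, matElem_weightedShift, matElem_weightedShift]
    by_cases h : j = k + n
    · rw [if_pos h.symm, if_pos (by omega)]; simp
    · rw [if_neg (Ne.symm h), if_neg (by omega)]; simp

theorem translation_mem_unitary (n : ℤ) : translation n ∈ unitary BddOp := by
  rw [Unitary.mem_iff, star_translation]
  constructor <;> (ext u k; simp)

theorem matElem_translation_conj (n : ℤ) (X : BddOp) (j k : ℤ) :
    matElem (translation n * X * star (translation n)) j k = matElem X (j + n) (k + n) := by
  rw [matElem_eq_apply, matElem_eq_apply, star_translation]
  have h : translation (-n) (basisVec k) = basisVec (k + n) := by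
    ext i
    rw [translation_apply, basisVec_apply, basisVec_apply]
    exact if_congr (by omega) rfl rfl
  change translation n (X (translation (-n) (basisVec k))) j = _
  rw [h, translation_apply]

/-- Conjugation by a translation shifts both matrix indices equally, so it respects the triangular
shape and the diagonal. -/
theorem IsDressing.translation_conj {X U : BddOp} (h : IsDressing X U) (n : ℤ) :
    IsDressing (translation n * X * star (translation n))
      (translation n * U * star (translation n)) := by
  have hn := translation_mem_unitary n
  have e : ∀ Z : BddOp, translation n * U * star (translation n)
      * exp (translation n * Z * star (translation n))
      = translation n * (U * exp Z) * star (translation n) := fun Z => by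
    rw [expOp_unitary_conj hn]
    calc translation n * U * star (translation n) * (translation n * exp Z * star (translation n))
        = translation n * U * (star (translation n) * translation n) * exp Z
          * star (translation n) := by noncomm_ring
      _ = _ := by rw [Unitary.star_mul_self_of_mem hn]; noncomm_ring
  have e2 : -(translation n * X * star (translation n))
      = translation n * (-X) * star (translation n) := by noncomm_ring
  refine ⟨mul_mem (mul_mem hn h.mem_unitary) (Unitary.star_mem hn), ?_, ?_, fun k => ?_, fun k => ?_⟩
  · rw [e2, e]
    intro j k hjk
    rw [matElem_translation_conj]
    exact h.lower _ _ (by omega)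
  · rw [e]
    intro j k hjk
    rw [matElem_translation_conj]
    exact h.upper _ _ (by omega)
  · rw [e2, e, matElem_translation_conj]
    exact h.lower_pos _
  · rw [e, matElem_translation_conj]
    exact h.upper_pos _

namespace JacobiMatrix

theorem star_toOp (J : JacobiMatrix) : star J.toOp = J.toOp := by
  rw [← tridiagonal_coeffs, star_tridiagonal]

theorem star_aeval_toOp (J : JacobiMatrix) (p : ℝ[X]) :
    star (aeval J.toOp p) = aeval J.toOp p := by
  rw [star_aeval, star_toOp]

theorem toOp_shift (J : JacobiMatrix) (n : ℤ) :
    (J.shift n).toOp = translation n * J.toOp * star (translation n) := by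
  refine ext_matElem fun j k => ?_
  rw [matElem_translation_conj, ← tridiagonal_coeffs, ← tridiagonal_coeffs, matElem_tridiagonal,
    matElem_tridiagonal]
  simp only [coeffs_fst_apply, coeffs_snd_apply, shift]
  rw [show j + n - 1 = j - 1 + n by ring, show j + n + 1 = j + 1 + n by ring]
  simp only [add_left_inj]

end JacobiMatrix

theorem hasDerivAt_mul_exp {U : ℝ → BddOp} {Y : BddOp} {t : ℝ} (hU : HasDerivAt U (Y * U t) t)
    (hUu : U t ∈ unitary BddOp) (Z : BddOp) :
    HasDerivAt (fun s : ℝ => U s * exp (s • Z))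
      ((Y + U t * Z * star (U t)) * (U t * exp (t • Z))) t := by
  have h := hU.mul (hasDerivAt_exp_smul_const' (𝕂 := ℝ) Z t)
  convert! h using 1
  calc (Y + U t * Z * star (U t)) * (U t * exp (t • Z))
      = Y * U t * exp (t • Z) + U t * Z * (star (U t) * U t) * exp (t • Z) := by noncomm_ring
    _ = Y * U t * exp (t • Z) + U t * (Z * exp (t • Z)) := by
      rw [Unitary.star_mul_self_of_mem hUu]; noncomm_ring

theorem continuous_toOp_of_isTodaFlow {p : ℝ[X]} {J : JacobiMatrix} {γ : ℝ → JacobiMatrix}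
    (h : IsTodaFlow p J γ) : Continuous fun t => (γ t).toOp :=
  continuous_iff_continuousAt.2 fun t => by
    obtain ⟨_, -, hd⟩ := h.2 t
    exact hd.continuousAt

/-- Every Toda flow is given by conjugation with the unitary factors of `exp (tp(J))`. -/
theorem IsTodaFlow.exists_isDressing {p : ℝ[X]} {J : JacobiMatrix} {γ : ℝ → JacobiMatrix}
    (h : IsTodaFlow p J γ) : ∃ U : ℝ → BddOp, U 0 = 1 ∧
      (∀ t, HasDerivAt U (todaLax p (γ t).coeffs * U t) t) ∧
      (∀ t, IsDressing (t • aeval J.toOp p) (U t)) ∧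
      ∀ t, (γ t).toOp = U t * J.toOp * star (U t) := by
  have hγ := continuous_toOp_of_isTodaFlow h
  have hXc : Continuous fun t => aeval (γ t).toOp p := (Polynomial.continuous_aeval p).comp hγ
  have hYc : Continuous fun t => todaLax p (γ t).coeffs := by
    simp only [todaLax, JacobiMatrix.tridiagonal_coeffs]
    exact (antisymmTruncation p.natDegree).continuous.comp hXc
  have hC : ∀ t, HasDerivAt (fun s => (γ s).toOp)
      (todaLax p (γ t).coeffs * (γ t).toOp - (γ t).toOp * todaLax p (γ t).coeffs) t := fun t => by
    obtain ⟨Y, hY, hd⟩ := h.2 t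
    rwa [hY.unique (isAntisymmPart_todaLax p (γ t))] at hd
  obtain ⟨U, hU0, hU, hUu⟩ := exists_unitary_solution hYc fun t => star_todaLax p _
  have hconj := lax_eq_conj hYc (fun t => star_todaLax p _) hU0 hU hC
  rw [h.1] at hconj
  have hX : ∀ t, aeval (γ t).toOp p = U t * aeval J.toOp p * star (U t) := fun t => by
    rw [hconj t, aeval_unitary_conj (hUu t)]
  have hreal : ∀ t n, ((matElem (aeval (γ t).toOp p) n n).re : ℂ)
      = matElem (aeval (γ t).toOp p) n n := fun t n => by
    rw [← JacobiMatrix.tridiagonal_coeffs]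
    exact ofReal_re_matElem (aeval_tridiagonal_mem_realMatrix _ p) n n
  have hmat := fun t j k => matElem_todaLax p (γ t).coeffs j k
  simp only [JacobiMatrix.tridiagonal_coeffs] at hmat
  have hlow : ∀ t, todaLax p (γ t).coeffs - aeval (γ t).toOp p ∈ lowerTriangular :=
    fun t j k hjk => by rw [matElem_sub, hmat, if_pos hjk, sub_self]
  have hupp : ∀ t, todaLax p (γ t).coeffs + aeval (γ t).toOp p ∈ upperTriangular :=
    fun t j k hjk => by rw [matElem_add, hmat, if_neg hjk.not_gt, if_pos hjk, neg_add_cancel]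
  have hWl : ∀ t, HasDerivAt (fun s : ℝ => U s * exp (s • -aeval J.toOp p))
      ((todaLax p (γ t).coeffs - aeval (γ t).toOp p) * (U t * exp (t • -aeval J.toOp p))) t :=
    fun t => by
    have h1 := hasDerivAt_mul_exp (hU t) (hUu t) (-aeval J.toOp p)
    rwa [mul_neg, neg_mul, ← hX, ← sub_eq_add_neg] at h1
  have hWu : ∀ t, HasDerivAt (fun s : ℝ => U s * exp (s • aeval J.toOp p))
      ((todaLax p (γ t).coeffs + aeval (γ t).toOp p) * (U t * exp (t • aeval J.toOp p))) t :=
    fun t => by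
    have h1 := hasDerivAt_mul_exp (hU t) (hUu t) (aeval J.toOp p)
    rwa [← hX] at h1
  -- The equation has lower triangular coefficients, so it has a solution inside the closed subspace
  -- of lower triangular operators; by uniqueness this is the given curve.
  have hl : ∀ t : ℝ, U t * exp (t • -aeval J.toOp p) ∈ lowerTriangular := by
    obtain ⟨W, hW0, hW, hWm⟩ := exists_linear_solution_mem (hYc.sub hXc) lowerTriangular
      isClosed_lowerTriangular (fun t _ hx => mul_mem_lowerTriangular (hlow t) hx)
      one_mem_lowerTriangular
    have e := eq_of_global_solutions (lipschitz_mul_left (hYc.sub hXc)) hWl hW (by simp [hU0, hW0])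
    intro t
    rw [show U t * exp (t • -aeval J.toOp p) = W t from congrFun e t]
    exact hWm t
  have hu : ∀ t : ℝ, U t * exp (t • aeval J.toOp p) ∈ upperTriangular := by
    obtain ⟨W, hW0, hW, hWm⟩ := exists_linear_solution_mem (hYc.add hXc) upperTriangular
      isClosed_upperTriangular (fun t _ hx => mul_mem_upperTriangular (hupp t) hx)
      one_mem_upperTriangular
    have e := eq_of_global_solutions (lipschitz_mul_left (hYc.add hXc)) hWu hW (by simp [hU0, hW0])
    intro t
    rw [show U t * exp (t • aeval J.toOp p) = W t from congrFun e t]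
    exact hWm t
  have hg : ∀ n, Continuous fun t => (matElem (aeval (γ t).toOp p) n n).re := fun n =>
    Complex.continuous_re.comp ((continuous_matElem n n).comp hXc)
  refine ⟨U, hU0, hU, fun t => ⟨hUu t, ?_, hu t, fun n => ?_, fun n => ?_⟩, hconj⟩
  · rw [← smul_neg]
    exact hl t
  · rw [← smul_neg]
    -- Diagonals of products of lower triangular operators multiply, so each diagonal entry solves a
    -- closed scalar equation with real coefficient and initial value 1.
    have h1 : ∀ t, HasDerivAt (fun s : ℝ => matElem (U s * exp (s • -aeval J.toOp p)) n n)
        (-(matElem (aeval (γ t).toOp p) n n).re •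
          matElem (U t * exp (t • -aeval J.toOp p)) n n) t := fun t => by
      convert! hasDerivAt_matElem (hWl t) n n using 1
      rw [matElem_mul_self_of_lowerTriangular (hlow t) (hl t), matElem_sub, hmat,
        if_neg (lt_irrefl n), if_neg (lt_irrefl n), zero_sub, ← hreal, Complex.real_smul,
        Complex.ofReal_neg, Complex.ofReal_re]
    rw [eq_exp_integral_smul (hg n).neg h1 t, hU0, zero_smul, exp_zero, one_mul, matElem_one,
      if_pos rfl]
    simpa [← Complex.ofReal_exp] using Real.exp_pos _
  · have h1 : ∀ t, HasDerivAt (fun s : ℝ => matElem (U s * exp (s • aeval J.toOp p)) n n)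
        ((matElem (aeval (γ t).toOp p) n n).re •
          matElem (U t * exp (t • aeval J.toOp p)) n n) t := fun t => by
      convert! hasDerivAt_matElem (hWu t) n n using 1
      rw [matElem_mul_self_of_upperTriangular (hupp t) (hu t), matElem_add, hmat,
        if_neg (lt_irrefl n), if_neg (lt_irrefl n), zero_add, ← hreal, Complex.real_smul]
      rfl
    rw [eq_exp_integral_smul (hg n) h1 t, hU0, zero_smul, exp_zero, one_mul, matElem_one,
      if_pos rfl]
    simpa [← Complex.ofReal_exp] using Real.exp_pos _

end Dressing

/-! ### The Toda maps and their action -/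

section TodaMap

theorem exists_isDressing_todaMap (p : ℝ[X]) (J : JacobiMatrix) :
    ∃ U : BddOp, IsDressing (aeval J.toOp p) U ∧ (todaMap p J).toOp = U * J.toOp * star U := by
  have h := exists_isTodaFlow p J
  obtain ⟨U, -, -, hU, hc⟩ := h.choose_spec.exists_isDressing
  refine ⟨U 1, by simpa using hU 1, ?_⟩
  rw [todaMap, dif_pos h, hc 1]

/-- The unitary factor of `exp (p(J))`, which conjugates `J` to `p · J`. -/
def todaUnitary (p : ℝ[X]) (J : JacobiMatrix) : BddOp := (exists_isDressing_todaMap p J).choose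

theorem isDressing_todaUnitary (p : ℝ[X]) (J : JacobiMatrix) :
    IsDressing (aeval J.toOp p) (todaUnitary p J) :=
  (exists_isDressing_todaMap p J).choose_spec.1

theorem toOp_todaMap (p : ℝ[X]) (J : JacobiMatrix) :
    (todaMap p J).toOp = todaUnitary p J * J.toOp * star (todaUnitary p J) :=
  (exists_isDressing_todaMap p J).choose_spec.2

theorem IsDressing.eq_todaUnitary {p : ℝ[X]} {J : JacobiMatrix} {U : BddOp}
    (h : IsDressing (aeval J.toOp p) U) : U = todaUnitary p J :=
  h.unique (J.star_aeval_toOp p) (isDressing_todaUnitary p J)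

theorem eq_todaMap_of_toOp_eq {p : ℝ[X]} {J K : JacobiMatrix}
    (h : K.toOp = todaUnitary p J * J.toOp * star (todaUnitary p J)) : K = todaMap p J :=
  JacobiMatrix.toOp_injective (h.trans (toOp_todaMap p J).symm)

/-- The factor at time t belongs to tp(J) = (tp)(J), as does the one attached to the time one map of
tp; uniqueness of the factorization makes them equal. No separate uniqueness argument for the
nonlinear flow is needed. -/
theorem IsTodaFlow.exists_todaUnitary {p : ℝ[X]} {J : JacobiMatrix} {γ : ℝ → JacobiMatrix}
    (h : IsTodaFlow p J γ) :
    (∀ t : ℝ, γ t = todaMap (t • p) J) ∧ todaUnitary ((0 : ℝ) • p) J = 1 ∧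
      ∀ t : ℝ, HasDerivAt (fun s : ℝ => todaUnitary (s • p) J)
        (todaLax p (γ t).coeffs * todaUnitary (t • p) J) t := by
  obtain ⟨U, hU0, hU, hd, hc⟩ := h.exists_isDressing
  have e : ∀ t : ℝ, U t = todaUnitary (t • p) J := fun t =>
    IsDressing.eq_todaUnitary (by simpa only [map_smul] using hd t)
  have e' : U = fun t : ℝ => todaUnitary (t • p) J := funext e
  refine ⟨fun t => eq_todaMap_of_toOp_eq (by rw [← e, hc]), by rw [← e, hU0], fun t => ?_⟩
  rw [← e, ← e']
  exact hU t

theorem IsTodaFlow.eq_todaMap {p : ℝ[X]} {J : JacobiMatrix} {γ : ℝ → JacobiMatrix}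
    (h : IsTodaFlow p J γ) : γ = fun t : ℝ => todaMap (t • p) J :=
  funext h.exists_todaUnitary.1

theorem isTodaFlow_todaMap (p : ℝ[X]) (J : JacobiMatrix) :
    IsTodaFlow p J fun t : ℝ => todaMap (t • p) J := by
  obtain ⟨γ, hγ⟩ := exists_isTodaFlow p J
  rwa [← hγ.eq_todaMap]

theorem aeval_toOp_todaMap (p q : ℝ[X]) (J : JacobiMatrix) :
    aeval (todaMap q J).toOp p = todaUnitary q J * aeval J.toOp p * star (todaUnitary q J) := by
  rw [toOp_todaMap, aeval_unitary_conj (isDressing_todaUnitary q J).mem_unitary]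

/-- The operators p(J) and q(J) commute, so the factors compose; conjugating p(J) by the factor of q
gives p(q · J). -/
theorem todaUnitary_add (p q : ℝ[X]) (J : JacobiMatrix) :
    todaUnitary (p + q) J = todaUnitary p (todaMap q J) * todaUnitary q J := by
  refine (IsDressing.eq_todaUnitary ?_).symm
  have h1 := isDressing_todaUnitary q J
  have h2 := isDressing_todaUnitary p (todaMap q J)
  rw [aeval_toOp_todaMap] at h2
  rw [add_comm, map_add]
  refine h1.mul h2 ?_
  rw [Commute, SemiconjBy, ← map_mul, ← map_mul, mul_comm]

theorem todaMap_add (p q : ℝ[X]) (J : JacobiMatrix) :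
    todaMap (p + q) J = todaMap p (todaMap q J) := by
  refine (eq_todaMap_of_toOp_eq ?_).symm
  rw [toOp_todaMap p, toOp_todaMap q, todaUnitary_add, star_mul]
  noncomm_ring

theorem todaUnitary_zero (J : JacobiMatrix) : todaUnitary 0 J = 1 :=
  (IsDressing.eq_todaUnitary (by simpa using IsDressing.zero)).symm

theorem todaMap_zero (J : JacobiMatrix) : todaMap 0 J = J :=
  (eq_todaMap_of_toOp_eq (by simp [todaUnitary_zero])).symm

/-- The translated factor is a dressing of p(SⁿJ), hence the dressing. -/
theorem todaUnitary_shift (p : ℝ[X]) (n : ℤ) (J : JacobiMatrix) :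
    todaUnitary p (J.shift n) = translation n * todaUnitary p J * star (translation n) := by
  refine (IsDressing.eq_todaUnitary ?_).symm
  rw [J.toOp_shift, aeval_unitary_conj (translation_mem_unitary n)]
  exact (isDressing_todaUnitary p J).translation_conj n

theorem todaMap_shift (p : ℝ[X]) (n : ℤ) (J : JacobiMatrix) :
    todaMap p (J.shift n) = (todaMap p J).shift n := by
  refine (eq_todaMap_of_toOp_eq ?_).symm
  rw [JacobiMatrix.toOp_shift, JacobiMatrix.toOp_shift, todaUnitary_shift, toOp_todaMap]
  have h := Unitary.star_mul_self_of_mem (translation_mem_unitary n)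
  simp only [star_mul, star_star]
  calc translation n * (todaUnitary p J * J.toOp * star (todaUnitary p J)) * star (translation n)
      = translation n * todaUnitary p J * 1 * J.toOp * 1 * (star (todaUnitary p J)
        * star (translation n)) := by noncomm_ring
    _ = _ := by rw [← h]; noncomm_ring

theorem shift_zero (J : JacobiMatrix) : J.shift 0 = J := by
  ext k <;> simp [JacobiMatrix.shift]

theorem shift_shift (m n : ℤ) (J : JacobiMatrix) : (J.shift m).shift n = J.shift (n + m) := by
  ext k <;> simp [JacobiMatrix.shift, add_assoc]

/-- The joint action of the Toda maps and the shift. -/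
@[reducible] def todaAction : AddAction (ℝ[X] × ℤ) JacobiMatrix where
  vadd g J := todaMap g.1 (J.shift g.2)
  zero_vadd J := by
    change todaMap 0 (J.shift 0) = J
    rw [shift_zero, todaMap_zero]
  add_vadd g h J := by
    change todaMap (g.1 + h.1) (J.shift (g.2 + h.2))
      = todaMap g.1 ((todaMap h.1 (J.shift h.2)).shift g.2)
    rw [todaMap_add, ← todaMap_shift, shift_shift]

end TodaMap

/-! ### Planar linear systems with a holomorphic parameter -/

section PlanarSystems

theorem lipschitz_mulVec {A : Type*} [NormedCommRing A] {B : ℝ → Matrix (Fin 2) (Fin 2) A}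
    (hB : ∀ i j, Continuous fun t => B t i j) (T : ℝ) :
    ∃ K : NNReal, ∀ t, |t| ≤ T → LipschitzWith K (fun x : Fin 2 → A => B t *ᵥ x) := by
  refine lipschitz_of_norm_sub_le (c := fun t => ∑ i, ∑ j, ‖B t i j‖)
    (continuous_finsetSum _ fun i _ => continuous_finsetSum _ fun j _ => (hB i j).norm)
    (fun t x y => ?_) T
  rw [← mulVec_sub]
  refine (pi_norm_le_iff_of_nonneg (by positivity)).2 fun i => ?_
  rw [mulVec, dotProduct, Finset.sum_mul]
  refine (norm_sum_le _ _).trans ?_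
  refine le_trans ?_ (Finset.single_le_sum (f := fun i => (∑ j, ‖B t i j‖) * ‖x - y‖)
    (fun i _ => by positivity) (Finset.mem_univ i))
  rw [Finset.sum_mul]
  gcongr with j
  refine (norm_mul_le _ _).trans ?_
  gcongr
  exact norm_le_pi_norm (x - y) j

theorem eq_of_planar_solutions {B : ℝ → Matrix (Fin 2) (Fin 2) ℂ}
    (hB : ∀ i j, Continuous fun t => B t i j) {x y : ℝ → Fin 2 → ℂ}
    (hx : ∀ t i, HasDerivAt (fun s => x s i) ((B t *ᵥ x t) i) t)
    (hy : ∀ t i, HasDerivAt (fun s => y s i) ((B t *ᵥ y t) i) t) (h0 : x 0 = y 0) : x = y :=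
  eq_of_global_solutions (lipschitz_mulVec hB) (fun t => hasDerivAt_pi.2 (hx t))
    (fun t => hasDerivAt_pi.2 (hy t)) h0

theorem exists_mulVec_solution {A : Type*} [NormedCommRing A] [NormedAlgebra ℝ A]
    [CompleteSpace A] {B : ℝ → Matrix (Fin 2) (Fin 2) A}
    (hB : ∀ i j, Continuous fun t => B t i j) (x₀ : Fin 2 → A) :
    ∃ x : ℝ → Fin 2 → A, x 0 = x₀ ∧
      ∀ t i, HasDerivAt (fun s => x s i) ((B t *ᵥ x t) i) t := by
  obtain ⟨x, hx0, hx⟩ := exists_global_solution (v := fun t x => B t *ᵥ x) (lipschitz_mulVec hB)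
    (fun x => continuous_pi fun i => by
      simp only [mulVec, dotProduct]
      exact continuous_finsetSum _ fun j _ => (hB i j).mul continuous_const) x₀
  exact ⟨x, hx0, fun t => hasDerivAt_pi.1 (hx t)⟩

variable {R : ℝ}

/-- The extension by zero of a function on a closed disc. -/
def extendDisc (f : C(Metric.closedBall (0 : ℂ) R, ℂ)) (z : ℂ) : ℂ :=
  open Classical in if h : z ∈ Metric.closedBall (0 : ℂ) R then f ⟨z, h⟩ else 0

theorem extendDisc_of_mem (f : C(Metric.closedBall (0 : ℂ) R, ℂ)) {z : ℂ}
    (h : z ∈ Metric.closedBall (0 : ℂ) R) : extendDisc f z = f ⟨z, h⟩ := dif_pos h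

/-- The algebra of continuous functions on a closed disc that are holomorphic in its interior and
real on the real axis. -/
def discAlgebra (R : ℝ) : Subalgebra ℝ C(Metric.closedBall (0 : ℂ) R, ℂ) where
  carrier := {f | DifferentiableOn ℂ (extendDisc f) (Metric.ball 0 R) ∧
    ∀ z : Metric.closedBall (0 : ℂ) R, (z : ℂ).im = 0 → (f z).im = 0}
  mul_mem' := fun {f g} hf hg => by
    refine ⟨(hf.1.mul hg.1).congr fun z hz => ?_, fun z hz => ?_⟩
    · have hz' := Metric.ball_subset_closedBall hz
      simp [extendDisc_of_mem, hz']
    · simp [hf.2 z hz, hg.2 z hz]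
  add_mem' := fun {f g} hf hg => by
    refine ⟨(hf.1.add hg.1).congr fun z hz => ?_, fun z hz => ?_⟩
    · have hz' := Metric.ball_subset_closedBall hz
      simp [extendDisc_of_mem, hz']
    · simp [hf.2 z hz, hg.2 z hz]
  algebraMap_mem' := fun r => by
    refine ⟨(differentiableOn_const (r : ℂ)).congr fun z hz => ?_, fun z hz => ?_⟩
    · rw [extendDisc_of_mem _ (Metric.ball_subset_closedBall hz)]
      rfl
    · change ((r : ℂ)).im = 0
      exact Complex.ofReal_im r

/-- Uniform limits of holomorphic functions are holomorphic. Completeness then allows ODEs to be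
solved inside this algebra. -/
theorem isClosed_discAlgebra (R : ℝ) :
    IsClosed (discAlgebra R : Set C(Metric.closedBall (0 : ℂ) R, ℂ)) := by
  refine isClosed_of_closure_subset fun f hf => ?_
  obtain ⟨F, hF, hlim⟩ := mem_closure_iff_seq_limit.1 hf
  have hu := ContinuousMap.tendsto_iff_tendstoUniformly.1 hlim
  refine ⟨?_, fun z hz => ?_⟩
  · refine TendstoLocallyUniformlyOn.differentiableOn (φ := Filter.atTop)
      (F := fun n => extendDisc (F n)) (TendstoUniformlyOn.tendstoLocallyUniformlyOn ?_)
      (Filter.Eventually.of_forall fun n => (hF n).1) Metric.isOpen_ball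
    rw [Metric.tendstoUniformlyOn_iff]
    rw [Metric.tendstoUniformly_iff] at hu
    intro ε hε
    filter_upwards [hu ε hε] with n hn z hz
    have hz' := Metric.ball_subset_closedBall hz
    rw [extendDisc_of_mem _ hz', extendDisc_of_mem _ hz']
    exact hn _
  · refine tendsto_nhds_unique ((Complex.continuous_im.tendsto _).comp (hu.tendsto_at z)) ?_
    simp only [Function.comp_def, (hF _).2 z hz]
    exact tendsto_const_nhds

/-- Planar linear systems that depend holomorphically on a parameter have solutions that do. -/
theorem exists_planar_solution (R : ℝ) {B : ℝ → ℂ → Matrix (Fin 2) (Fin 2) ℂ}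
    (hc : ∀ i j, Continuous fun q : ℝ × ℂ => B q.1 q.2 i j)
    (hd : ∀ t i j, Differentiable ℂ fun z => B t z i j)
    (hr : ∀ t (x : ℝ) i j, (B t x i j).im = 0) (e : Fin 2 → ℝ) :
    ∃ x : ℝ → ℂ → Fin 2 → ℂ, (∀ z ∈ Metric.ball (0 : ℂ) R, x 0 z = fun i => (e i : ℂ)) ∧
      (∀ z ∈ Metric.ball (0 : ℂ) R, ∀ t i,
        HasDerivAt (fun s => x s z i) ((B t z *ᵥ x t z) i) t) ∧
      (∀ t i, DifferentiableOn ℂ (fun z => x t z i) (Metric.ball 0 R)) ∧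
      ∀ t i, ∀ y : ℝ, (y : ℂ) ∈ Metric.ball (0 : ℂ) R → (x t y i).im = 0 := by
  have : CompleteSpace (discAlgebra R) := (isClosed_discAlgebra R).completeSpace_coe
  let Bc : Fin 2 → Fin 2 → C(ℝ × Metric.closedBall (0 : ℂ) R, ℂ) := fun i j =>
    ⟨fun q => B q.1 q.2 i j, (hc i j).comp (continuous_id.prodMap continuous_subtype_val)⟩
  have hmem : ∀ t i j, (Bc i j).curry t ∈ discAlgebra R := fun t i j => by
    refine ⟨(hd t i j).differentiableOn.congr fun z hz => ?_, fun z hz => ?_⟩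
    · rw [extendDisc_of_mem _ (Metric.ball_subset_closedBall hz)]
      rfl
    · have : (z : ℂ) = ((z : ℂ).re : ℂ) := Complex.ext rfl hz
      change (B t z i j).im = 0
      rw [this]
      exact hr t _ i j
  let B' : ℝ → Matrix (Fin 2) (Fin 2) (discAlgebra R) := fun t i j =>
    ⟨(Bc i j).curry t, hmem t i j⟩
  have hB' : ∀ i j, Continuous fun t => B' t i j := fun i j =>
    ((Bc i j).curry.continuous).subtype_mk _
  -- The unknowns are functions of z in the disc algebra, so holomorphy and reality of the solution
  -- are built in; evaluation at z, a continuous linear map, recovers the pointwise equation.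
  obtain ⟨x, hx0, hx⟩ := exists_mulVec_solution hB' fun i => algebraMap ℝ (discAlgebra R) (e i)
  refine ⟨fun t z i => extendDisc (x t i : C(Metric.closedBall (0 : ℂ) R, ℂ)) z,
    fun z hz => ?_, fun z hz t i => ?_, fun t i => (x t i).2.1, fun t i y hy => ?_⟩
  · funext i
    change extendDisc (x 0 i : C(Metric.closedBall (0 : ℂ) R, ℂ)) z = _
    rw [extendDisc_of_mem _ (Metric.ball_subset_closedBall hz), hx0]
    rfl
  · have hz' := Metric.ball_subset_closedBall hz
    simp only [extendDisc_of_mem _ hz']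
    have h1 := hx t i
    have h2 := ((ContinuousMap.evalCLM ℝ (⟨z, hz'⟩ : Metric.closedBall (0 : ℂ) R)).comp
      (discAlgebra R).toSubmodule.subtypeL).hasFDerivAt.comp_hasDerivAt t h1
    convert! h2 using 1
  · change (extendDisc (x t i : C(Metric.closedBall (0 : ℂ) R, ℂ)) y).im = 0
    rw [extendDisc_of_mem _ (Metric.ball_subset_closedBall hy)]
    exact (x t i).2.2 _ (Complex.ofReal_im y)

end PlanarSystems

/-! ### The matrix B_p and the transfer matrices T(p; J) -/

section TodaMatrix

theorem continuous_todaB (p : ℝ[X]) {γ : ℝ → JacobiMatrix} (hγ : Continuous fun t => (γ t).toOp)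
    (i j : Fin 2) : Continuous fun q : ℝ × ℂ => todaB p q.2 (γ q.1) i j := by
  have hm : ∀ (A : BddOp) (k : ℕ) (m n : ℤ),
      Continuous fun q : ℝ × ℂ => matElem (A * (γ q.1).toOp ^ k) m n := fun A k m n =>
    (continuous_matElem m n).comp (continuous_const.mul ((hγ.comp continuous_fst).pow k))
  have hm' : ∀ (k : ℕ) (m n : ℤ),
      Continuous fun q : ℝ × ℂ => matElem ((γ q.1).toOp ^ k) m n := fun k m n => by
    simpa only [one_mul] using hm 1 k m n
  have ha : ∀ n, Continuous fun q : ℝ × ℂ => ((γ q.1).a n : ℂ) := fun n => by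
    simpa only [pow_one, JacobiMatrix.matElem_toOp_succ] using hm' 1 n (n + 1)
  have hb : ∀ n, Continuous fun q : ℝ × ℂ => ((γ q.1).b n : ℂ) := fun n => by
    simpa only [pow_one, JacobiMatrix.matElem_toOp_self] using hm' 1 n n
  have hG : ∀ n, Continuous fun q : ℝ × ℂ => todaG p q.2 (γ q.1) n := fun n => by
    simp only [todaG, todaGMonomial, Polynomial.sum_def]
    fun_prop
  have hH : ∀ n, Continuous fun q : ℝ × ℂ => todaH p q.2 (γ q.1) n := fun n => by
    simp only [todaH, todaHMonomial, Polynomial.sum_def]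
    fun_prop
  fin_cases i <;> fin_cases j <;> simp [todaB] <;> fun_prop

theorem differentiable_todaB (p : ℝ[X]) (J : JacobiMatrix) (i j : Fin 2) :
    Differentiable ℂ fun z => todaB p z J i j := by
  have hG : ∀ n, Differentiable ℂ fun z => todaG p z J n := fun n => by
    simp only [todaG, todaGMonomial, Polynomial.sum_def]
    fun_prop
  have hH : ∀ n, Differentiable ℂ fun z => todaH p z J n := fun n => by
    simp only [todaH, todaHMonomial, Polynomial.sum_def]
    fun_prop
  fin_cases i <;> fin_cases j <;> simp [todaB] <;> fun_prop

theorem im_todaB (p : ℝ[X]) (J : JacobiMatrix) (x : ℝ) (i j : Fin 2) :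
    (todaB p x J i j).im = 0 := by
  have hJ : J.toOp ∈ realMatrix := by
    rw [← J.tridiagonal_coeffs]; exact tridiagonal_mem_realMatrix _
  obtain ⟨f, hf⟩ : ∃ f : ℕ → ℤ → ℤ → ℝ, ∀ k m n, matElem (J.toOp ^ k) m n = f k m n :=
    ⟨_, fun k m n => (ofReal_re_matElem (pow_mem hJ k) m n).symm⟩
  have hS : shiftOp ∈ realMatrix := fun m n => by
    rw [shiftOp, matElem_weightedShift]
    split_ifs <;> simp
  obtain ⟨g, hg⟩ : ∃ g : ℕ → ℤ → ℤ → ℝ, ∀ k m n, matElem (shiftOp * J.toOp ^ k) m n = g k m n :=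
    ⟨_, fun k m n => (ofReal_re_matElem (mul_mem hS (pow_mem hJ k)) m n).symm⟩
  have hG : ∀ n, ∃ r : ℝ, todaG p x J n = r := fun n => by
    simp only [todaG, todaGMonomial, Polynomial.sum_def]
    simp only [hf]
    exact ⟨_, by norm_cast⟩
  have hH : ∀ n, ∃ r : ℝ, todaH p x J n = r := fun n => by
    simp only [todaH, todaHMonomial, Polynomial.sum_def]
    simp only [hf, hg]
    exact ⟨_, by norm_cast⟩
  obtain ⟨r, hr⟩ := hG 0
  obtain ⟨r', hr'⟩ := hG 1
  obtain ⟨s, hs⟩ := hH 1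
  rw [todaB, hr, hr', hs]
  fin_cases i <;> fin_cases j <;> simp [← Complex.ofReal_pow]

theorem todaB_smul (t : ℝ) (p : ℝ[X]) (z : ℂ) (J : JacobiMatrix) :
    todaB (t • p) z J = (t : ℂ) • todaB p z J := by
  have hG : ∀ n, todaG (t • p) z J n = t * todaG p z J n := fun n => by
    rw [todaG, Polynomial.sum_smul_index _ _ _ (by simp), todaG, Polynomial.sum_def,
      Polynomial.sum_def, Finset.mul_sum]
    exact Finset.sum_congr rfl fun k _ => by push_cast; ring
  have hH : ∀ n, todaH (t • p) z J n = t * todaH p z J n := fun n => by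
    rw [todaH, Polynomial.sum_smul_index _ _ _ (by simp), todaH, Polynomial.sum_def,
      Polynomial.sum_def, Finset.mul_sum]
    exact Finset.sum_congr rfl fun k _ => by push_cast; ring
  ext i j
  fin_cases i <;> fin_cases j <;> simp [todaB, hG, hH] <;> ring

theorem continuous_toOp_todaMap (p : ℝ[X]) (J : JacobiMatrix) :
    Continuous fun t : ℝ => (todaMap (t • p) J).toOp :=
  continuous_toOp_of_isTodaFlow (isTodaFlow_todaMap p J)

theorem continuous_todaB_todaMap (p : ℝ[X]) (J : JacobiMatrix) (z : ℂ) (i j : Fin 2) :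
    Continuous fun t : ℝ => todaB p z (todaMap (t • p) J) i j := by
  have h := continuous_todaB p (γ := fun t : ℝ => todaMap (t • p) J)
    (continuous_toOp_todaMap p J) i j
  have h' : Continuous fun t : ℝ => ((t, z) : ℝ × ℂ) := by fun_prop
  simpa only [Function.comp_def] using h.comp h'

theorem isTodaTransfer_iff_columns {p : ℝ[X]} {J : JacobiMatrix} {z : ℂ}
    {M : ℝ → Matrix (Fin 2) (Fin 2) ℂ} : IsTodaTransfer p J z M ↔ M 0 = 1 ∧ ∀ (j : Fin 2) t i,
      HasDerivAt (fun s => (M s).col j i) ((todaB p z (todaMap (t • p) J) *ᵥ (M t).col j) i) t :=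
  and_congr_right fun _ => ⟨fun h j t i => h t i j, fun h t i j => h j t i⟩

theorem IsTodaTransfer.unique {p : ℝ[X]} {J : JacobiMatrix} {z : ℂ}
    {M N : ℝ → Matrix (Fin 2) (Fin 2) ℂ} (hM : IsTodaTransfer p J z M)
    (hN : IsTodaTransfer p J z N) : M = N := by
  have hM' := isTodaTransfer_iff_columns.1 hM
  have hN' := isTodaTransfer_iff_columns.1 hN
  funext t
  ext i j
  have h := eq_of_planar_solutions (continuous_todaB_todaMap p J z) (hM'.2 j) (hN'.2 j)
    (by rw [hM'.1, hN'.1])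
  exact congrFun (congrFun h t) i

theorem exists_holomorphic_todaTransfer (p : ℝ[X]) (J : JacobiMatrix) (R : ℝ) :
    ∃ M : ℝ → ℂ → Matrix (Fin 2) (Fin 2) ℂ,
      (∀ z ∈ Metric.ball (0 : ℂ) R, IsTodaTransfer p J z fun t => M t z) ∧
      (∀ t i j, DifferentiableOn ℂ (fun z => M t z i j) (Metric.ball 0 R)) ∧
      ∀ t i j, ∀ y : ℝ, (y : ℂ) ∈ Metric.ball (0 : ℂ) R → (M t y i j).im = 0 := by
  have hex := exists_planar_solution R (B := fun t z => todaB p z (todaMap (t • p) J))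
    (continuous_todaB p (γ := fun t : ℝ => todaMap (t • p) J) (continuous_toOp_todaMap p J))
    (fun t => differentiable_todaB p _) (fun t => im_todaB p _)
  choose x hx0 hx hd hr using fun j : Fin 2 => hex (Pi.single j 1)
  refine ⟨fun t z => of fun i j => x j t z i, fun z hz => isTodaTransfer_iff_columns.2
    ⟨?_, fun j => hx j z hz⟩, fun t i j => hd j t i, fun t i j => hr j t i⟩
  ext i j
  change x j 0 z i = _
  rw [hx0 j z hz, one_apply]
  by_cases h : i = j
  · simp [h]
  · simp [h]

theorem exists_isTodaTransfer (p : ℝ[X]) (J : JacobiMatrix) (z : ℂ) :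
    ∃ M : ℝ → Matrix (Fin 2) (Fin 2) ℂ, IsTodaTransfer p J z M := by
  obtain ⟨M, hM, -⟩ := exists_holomorphic_todaTransfer p J (‖z‖ + 1)
  exact ⟨_, hM z (by simp)⟩

theorem IsTodaTransfer.apply_one {p : ℝ[X]} {J : JacobiMatrix} {z : ℂ}
    {M : ℝ → Matrix (Fin 2) (Fin 2) ℂ} (hM : IsTodaTransfer p J z M) :
    M 1 = todaTransfer p J z := by
  have h : ∃ M : ℝ → Matrix (Fin 2) (Fin 2) ℂ, IsTodaTransfer p J z M := ⟨M, hM⟩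
  rw [todaTransfer, dif_pos h, hM.unique h.choose_spec]

/-- B is linear in p, so s ↦ M(st) solves the equation for the polynomial tp; its value at s = 1 is
M(t). -/
theorem IsTodaTransfer.eq_todaTransfer {p : ℝ[X]} {J : JacobiMatrix} {z : ℂ}
    {M : ℝ → Matrix (Fin 2) (Fin 2) ℂ} (hM : IsTodaTransfer p J z M) :
    M = fun t : ℝ => todaTransfer (t • p) J z := by
  funext t
  have h : IsTodaTransfer (t • p) J z fun s => M (s * t) := by
    refine ⟨by simp [hM.1], fun s i j => ?_⟩
    have h1 := HasDerivAt.scomp s (h := fun s : ℝ => s * t) (hM.2 (s * t) i j)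
      ((hasDerivAt_id s).mul_const t)
    convert! h1 using 1
    rw [todaB_smul, smul_smul, smul_mul, one_mul, Matrix.smul_apply, Complex.real_smul,
      smul_eq_mul]
  rw [← h.apply_one, one_mul]

theorem isTodaTransfer_todaTransfer (p : ℝ[X]) (J : JacobiMatrix) (z : ℂ) :
    IsTodaTransfer p J z fun t : ℝ => todaTransfer (t • p) J z := by
  obtain ⟨M, hM⟩ := exists_isTodaTransfer p J z
  rwa [← hM.eq_todaTransfer]

theorem differentiable_todaTransfer (p : ℝ[X]) (J : JacobiMatrix) (i j : Fin 2) :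
    Differentiable ℂ fun z => todaTransfer p J z i j := fun z => by
  obtain ⟨M, hM, hd, -⟩ := exists_holomorphic_todaTransfer p J (‖z‖ + 1)
  have hz : Metric.ball (0 : ℂ) (‖z‖ + 1) ∈ nhds z := Metric.isOpen_ball.mem_nhds (by simp)
  refine ((hd 1 i j).differentiableAt hz).congr_of_eventuallyEq ?_
  filter_upwards [hz] with w hw
  rw [← (hM w hw).apply_one]

theorem im_todaTransfer (p : ℝ[X]) (J : JacobiMatrix) (x : ℝ) (i j : Fin 2) :
    (todaTransfer p J x i j).im = 0 := by
  obtain ⟨M, hM, -, hr⟩ := exists_holomorphic_todaTransfer p J (‖(x : ℂ)‖ + 1)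
  have hx : (x : ℂ) ∈ Metric.ball (0 : ℂ) (‖(x : ℂ)‖ + 1) := by simp
  rw [← (hM x hx).apply_one]
  exact hr 1 i j x hx

theorem det_todaTransfer (p : ℝ[X]) (J : JacobiMatrix) (z : ℂ) : (todaTransfer p J z).det = 1 := by
  obtain ⟨M, hM⟩ := exists_isTodaTransfer p J z
  -- Liouville's formula: B_p has trace zero.
  have hd : ∀ t, HasDerivAt (fun s => (M s).det) 0 t := fun t => by
    have e : ∀ N : Matrix (Fin 2) (Fin 2) ℂ, N.det = N 0 0 * N 1 1 - N 0 1 * N 1 0 := det_fin_two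
    simp only [e]
    convert! ((hM.2 t 0 0).mul (hM.2 t 1 1)).sub ((hM.2 t 0 1).mul (hM.2 t 1 0)) using 1
    simp only [todaB, Matrix.mul_apply, Fin.sum_univ_two, of_apply, cons_val', cons_val_zero,
      cons_val_one, cons_val_fin_one]
    ring
  have h := is_const_of_deriv_eq_zero (fun t => (hd t).differentiableAt) (fun t => (hd t).deriv) 1 0
  rw [← hM.apply_one]
  simpa [hM.1] using h

/-- The entire function `z ↦ T(p; J)(z)`. -/
def todaTransferSL (p : ℝ[X]) (J : JacobiMatrix) : SLEntire :=
  ⟨fun z => ⟨todaTransfer p J z, det_todaTransfer p J z⟩,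
    differentiable_todaTransfer p J, im_todaTransfer p J⟩

@[simp] theorem eval_todaTransferSL (p : ℝ[X]) (J : JacobiMatrix) (z : ℂ) :
    SLEntire.eval (todaTransferSL p J) z = todaTransfer p J z := rfl

end TodaMatrix

/-! ### Rows of the Lax operator on half-line solutions -/

section RowFormula

variable (z : ℂ) (J : JacobiMatrix) (n : ℤ)

/-- The sums of off-diagonal matrix elements that occur in `todaHMonomial`. -/
def todaOffMonomial (k : ℕ) : ℂ :=
  ∑ j ∈ Finset.range k, z ^ (k - 1 - j) * matElem (J.toOp ^ j) n (n + 1)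

theorem sum_range_succ_pow_mul (f : ℕ → ℂ) (k : ℕ) :
    ∑ j ∈ Finset.range (k + 1), z ^ (k + 1 - 1 - j) * f j
      = z * ∑ j ∈ Finset.range k, z ^ (k - 1 - j) * f j + f k := by
  rw [Finset.sum_range_succ, Finset.mul_sum]
  congr 1
  · refine Finset.sum_congr rfl fun j hj => ?_
    have := Finset.mem_range.1 hj
    rw [show k + 1 - 1 - j = (k - 1 - j) + 1 by omega]
    ring
  · simp

theorem todaGMonomial_succ (k : ℕ) : todaGMonomial (k + 1) z J n
    = z * todaGMonomial k z J n + matElem (J.toOp ^ k) n n :=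
  sum_range_succ_pow_mul z (fun j => matElem (J.toOp ^ j) n n) k

theorem todaOffMonomial_succ (k : ℕ) : todaOffMonomial z J n (k + 1)
    = z * todaOffMonomial z J n k + matElem (J.toOp ^ k) n (n + 1) :=
  sum_range_succ_pow_mul z (fun j => matElem (J.toOp ^ j) n (n + 1)) k

theorem matElem_aeval_toOp_comm (p : ℝ[X]) (j k : ℤ) :
    matElem (aeval J.toOp p) j k = matElem (aeval J.toOp p) k j := by
  rw [← J.tridiagonal_coeffs, matElem_aeval_tridiagonal_comm]

theorem matElem_pow_toOp_comm (i : ℕ) (j k : ℤ) :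
    matElem (J.toOp ^ i) j k = matElem (J.toOp ^ i) k j := by
  simpa using matElem_aeval_toOp_comm J (X ^ i) j k

theorem todaHMonomial_eq (k : ℕ) : todaHMonomial k z J n
    = z ^ k - matElem (J.toOp ^ k) n n + 2 * (J.a n : ℂ) * todaOffMonomial z J n k := by
  rw [todaHMonomial, todaOffMonomial]
  congr 2
  have h : ∀ j, matElem (shiftOp * J.toOp ^ j) n n = matElem (J.toOp ^ j) n (n + 1) := fun j => by
    rw [matElem_pow_toOp_comm, matElem_eq_apply, matElem_eq_apply]
    change shiftOp ((J.toOp ^ j) (basisVec n)) n = _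
    simp [shiftOp]
  simp only [h]
  refine Finset.sum_subset (fun j hj => Finset.mem_range.2 (Finset.mem_Ico.1 hj).2) fun j hj hj' => ?_
  have hj0 : j = 0 := by
    rw [Finset.mem_range] at hj
    rw [Finset.mem_Ico] at hj'
    omega
  rw [hj0, pow_zero, matElem_one, if_neg (by omega), mul_zero]

variable (p : ℝ[X])

/-- The linear extension of `todaOffMonomial` to polynomials. -/
def todaOff : ℂ := p.sum fun k c => (c : ℂ) * todaOffMonomial z J n k

theorem aeval_eq_polynomial_sum : aeval z p = p.sum fun k c => (c : ℂ) * z ^ k := by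
  rw [aeval_def, eval₂_eq_sum]
  rfl

theorem matElem_aeval_eq_sum (A : BddOp) (j k : ℤ) :
    matElem (aeval A p) j k = p.sum fun i c => (c : ℂ) * matElem (A ^ i) j k := by
  rw [aeval_eq_sum_range, matElem_sum, Polynomial.sum_over_range _ (by simp)]
  simp

theorem aeval_apply_eq_sum (A : BddOp) (u : EllTwo) (k : ℤ) :
    aeval A p u k = p.sum fun i c => (c : ℂ) * (A ^ i) u k := by
  rw [aeval_eq_sum_range, Polynomial.sum_over_range _ (by simp), _root_.sum_apply]
  change coordL k _ = _
  rw [map_sum]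
  simp

theorem todaH_eq : todaH p z J n
    = aeval z p - matElem (aeval J.toOp p) n n + 2 * (J.a n : ℂ) * todaOff z J n p := by
  simp only [todaH, todaHMonomial_eq, aeval_eq_polynomial_sum, matElem_aeval_eq_sum, todaOff,
    Polynomial.sum_def, Finset.mul_sum, ← Finset.sum_sub_distrib, ← Finset.sum_add_distrib]
  exact Finset.sum_congr rfl fun k _ => by ring

/-- This is the (1,1) element of J^k - z^k = (J - z) ∑ z^{k-1-j} J^j. -/
theorem matElem_pow_one_one (k : ℕ) : matElem (J.toOp ^ k) 1 1
    = z ^ k + J.a 0 * todaOffMonomial z J 0 k + J.a 1 * todaOffMonomial z J 1 k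
      - (z - J.b 1) * todaGMonomial k z J 1 := by
  induction k with
  | zero => simp [todaOffMonomial, todaGMonomial, matElem_one]
  | succ k ih =>
    have h := matElem_mul_tridiagonal J.coeffs (J.toOp ^ k) 1 1
    rw [J.tridiagonal_coeffs, ← pow_succ, matElem_pow_toOp_comm J k 1 (1 - 1)] at h
    simp only [JacobiMatrix.coeffs_fst_apply, JacobiMatrix.coeffs_snd_apply, sub_self] at h
    rw [todaOffMonomial_succ, todaOffMonomial_succ, todaGMonomial_succ, h, zero_add]
    linear_combination z * ih

theorem matElem_aeval_one_one : matElem (aeval J.toOp p) 1 1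
    = aeval z p + J.a 0 * todaOff z J 0 p + J.a 1 * todaOff z J 1 p
      - (z - J.b 1) * todaG p z J 1 := by
  rw [matElem_aeval_eq_sum]
  simp only [matElem_pow_one_one z, aeval_eq_polynomial_sum, todaOff, todaG,
    Polynomial.sum_def, Finset.mul_sum, ← Finset.sum_sub_distrib, ← Finset.sum_add_distrib]
  exact Finset.sum_congr rfl fun k _ => by ring

/-- The left side is the logarithmic derivative of a_0 along the flow; the identity converts the
rate H_0 of the site 0 into the entry of B_p that involves only H_1 and G_1. -/
theorem todaH_zero_add_todaH_one : matElem (aeval J.toOp p) 1 1 - matElem (aeval J.toOp p) 0 0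
    = todaH p z J 0 + todaH p z J 1 - 2 * (z - J.b 1) * todaG p z J 1 := by
  rw [todaH_eq, todaH_eq]
  linear_combination 2 * matElem_aeval_one_one z J p

/-- The projection to the coordinates `k ≤ n`. -/
def truncBelow : BddOp :=
  weightedShift (fun k => if k ≤ n then 1 else 0)
    ⟨1, fun k => by split_ifs <;> simp⟩ 0

theorem truncBelow_apply (u : EllTwo) (k : ℤ) :
    truncBelow n u k = if k ≤ n then u k else 0 := by
  rw [truncBelow, weightedShift_apply]
  split_ifs <;> simp

theorem matElem_mul_truncBelow (A : BddOp) (j k : ℤ) :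
    matElem (A * truncBelow n) j k = if k ≤ n then matElem A j k else 0 := by
  have h : truncBelow n (basisVec k) = if k ≤ n then basisVec k else 0 := by
    ext i
    rw [truncBelow_apply, basisVec_apply]
    rcases eq_or_ne i k with rfl | hik
    · rw [if_pos rfl]
      by_cases hi : i ≤ n
      · rw [if_pos hi, if_pos hi, basisVec_apply, if_pos rfl]
      · rw [if_neg hi, if_neg hi]; rfl
    · rw [if_neg hik, ite_self]
      by_cases hk : k ≤ n
      · rw [if_pos hk, basisVec_apply, if_neg hik]
      · rw [if_neg hk]; rfl
  rw [matElem_eq_apply, matElem_eq_apply]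
  change A (truncBelow n (basisVec k)) j = _
  rw [h]
  split_ifs <;> simp

variable {n} in
theorem apply_eq_of_matElem_eq {A B : BddOp} (h : ∀ k, matElem A n k = matElem B n k) (u : EllTwo) :
    A u n = B u n := by
  have h1 := hasSum_matElem_mul_apply A u n
  simp only [h] at h1
  exact h1.unique (hasSum_matElem_mul_apply B u n)

variable {z J n}

/-- Cutting off a solution breaks the equation only at the two sites joined by the cut bond, so (J -
z) of the truncation is a combination of δ_n and δ_{n+1}. -/
theorem toOp_truncBelow {u : EllTwo} (h : ∀ k ≤ n, J.toOp u k = z * u k) :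
    J.toOp (truncBelow n u) = z • truncBelow n u
      + ((J.a n * u n) • basisVec (n + 1) - (J.a n * u (n + 1)) • basisVec n) := by
  ext k
  have e : (z • truncBelow n u + ((J.a n * u n) • basisVec (n + 1)
      - (J.a n * u (n + 1)) • basisVec n)) k = z * truncBelow n u k
      + ((J.a n * u n) * basisVec (n + 1) k - (J.a n * u (n + 1)) * basisVec n k) := rfl
  rw [e, JacobiMatrix.toOp_apply]
  simp only [truncBelow_apply, basisVec_apply]
  rcases lt_trichotomy k n with hk | rfl | hk
  · have := h k hk.le
    rw [JacobiMatrix.toOp_apply] at this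
    rw [if_pos (by omega), if_pos (by omega), if_pos (by omega), if_neg (by omega),
      if_neg (by omega), this]
    ring
  · have := h k le_rfl
    rw [JacobiMatrix.toOp_apply] at this
    rw [if_neg (by omega), if_pos (by omega), if_pos (by omega), if_neg (by omega), if_pos rfl]
    linear_combination this
  · rcases eq_or_ne k (n + 1) with rfl | hk'
    · rw [if_neg (by omega), if_pos (by omega), if_neg (by omega), if_pos rfl, if_neg (by omega),
        add_sub_cancel_right]
      ring
    · rw [if_neg (by omega), if_neg (by omega), if_neg (by omega), if_neg (by omega),
        if_neg (by omega)]
      ring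

theorem toOp_sub_truncBelow {u : EllTwo} (h : ∀ k, n < k → J.toOp u k = z * u k) :
    J.toOp (u - truncBelow n u) = z • (u - truncBelow n u)
      - ((J.a n * u n) • basisVec (n + 1) - (J.a n * u (n + 1)) • basisVec n) := by
  ext k
  have e : (z • (u - truncBelow n u) - ((J.a n * u n) • basisVec (n + 1)
      - (J.a n * u (n + 1)) • basisVec n)) k = z * (u k - truncBelow n u k)
      - ((J.a n * u n) * basisVec (n + 1) k - (J.a n * u (n + 1)) * basisVec n k) := rfl
  have e' : ∀ k, (u - truncBelow n u) k = u k - truncBelow n u k := fun k => rfl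
  rw [e, JacobiMatrix.toOp_apply]
  simp only [e', truncBelow_apply, basisVec_apply]
  rcases lt_trichotomy k n with hk | rfl | hk
  · rw [if_pos (by omega), if_pos (by omega), if_pos (by omega), if_neg (by omega),
      if_neg (by omega)]
    ring
  · rw [if_neg (by omega), if_pos (by omega), if_pos (by omega), if_neg (by omega), if_pos rfl]
    ring
  · have := h k hk
    rw [JacobiMatrix.toOp_apply] at this
    rcases eq_or_ne k (n + 1) with rfl | hk'
    · rw [add_sub_cancel_right] at this ⊢
      rw [if_neg (by omega), if_pos (by omega), if_neg (by omega), if_pos rfl, if_neg (by omega)]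
      linear_combination this
    · rw [if_neg (by omega), if_neg (by omega), if_neg (by omega), if_neg (by omega),
        if_neg (by omega)]
      linear_combination this

/-- Write J^k = z^k + (∑ z^{k-1-j} J^j)(J - z): the second term sees only the two boundary vectors,
and its row n gives the sums in G_n and H_n. -/
theorem pow_apply_eq_of_toOp_eq {v : EllTwo} {α β : ℂ}
    (h : J.toOp v = z • v + (α • basisVec (n + 1) - β • basisVec n)) (k : ℕ) :
    (J.toOp ^ k) v n = z ^ k * v n + α * todaOffMonomial z J n k - β * todaGMonomial k z J n := by
  induction k with
  | zero => simp [todaOffMonomial, todaGMonomial]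
  | succ k ih =>
    rw [pow_succ]
    change (J.toOp ^ k) (J.toOp v) n = _
    rw [h, map_add, map_sub, map_smul, map_smul, map_smul]
    change z * (J.toOp ^ k) v n + (α * (J.toOp ^ k) (basisVec (n + 1)) n
      - β * (J.toOp ^ k) (basisVec n) n) = _
    rw [← matElem_eq_apply, ← matElem_eq_apply, ih, todaOffMonomial_succ, todaGMonomial_succ]
    ring

theorem aeval_apply_eq_of_toOp_eq {v : EllTwo} {α β : ℂ}
    (h : J.toOp v = z • v + (α • basisVec (n + 1) - β • basisVec n)) :
    aeval J.toOp p v n = aeval z p * v n + α * todaOff z J n p - β * todaG p z J n := by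
  rw [aeval_apply_eq_sum]
  simp only [pow_apply_eq_of_toOp_eq h, aeval_eq_polynomial_sum, todaOff, todaG,
    Polynomial.sum_def, Finset.mul_sum, Finset.sum_mul, ← Finset.sum_sub_distrib,
    ← Finset.sum_add_distrib]
  exact Finset.sum_congr rfl fun k _ => by ring

theorem matElem_todaLax_coeffs (j k : ℤ) : matElem (todaLax p J.coeffs) j k =
    if j < k then matElem (aeval J.toOp p) j k
    else if k < j then -matElem (aeval J.toOp p) j k else 0 := by
  rw [matElem_todaLax, J.tridiagonal_coeffs]

/-- The action of the Lax operator on vectors that solve the eigenvalue equation to the left. -/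
theorem todaLax_apply_of_left {u : EllTwo} (h : ∀ k ≤ n, J.toOp u k = z * u k) :
    todaLax p J.coeffs u n - (aeval J.toOp p u n - aeval z p * u n)
      = 2 * J.a n * todaG p z J n * u (n + 1) - todaH p z J n * u n := by
  -- Row n of p(J)_a - p(J) vanishes right of the diagonal and is -2p(J) left of it. The factor -2
  -- on the truncation overshoots at the diagonal, which the multiple of the identity corrects.
  have h1 : (todaLax p J.coeffs - aeval J.toOp p) u n
      = ((-2 : ℂ) • (aeval J.toOp p * truncBelow n)
        + matElem (aeval J.toOp p) n n • (1 : BddOp)) u n := by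
    refine apply_eq_of_matElem_eq (fun k => ?_) u
    rw [matElem_sub, matElem_todaLax_coeffs, matElem_add, matElem_smul, matElem_smul,
      matElem_mul_truncBelow, matElem_one]
    rcases lt_trichotomy n k with hk | rfl | hk
    · rw [if_pos hk, if_neg (by omega), if_neg (by omega)]; ring
    · rw [if_neg (by omega), if_neg (by omega), if_pos le_rfl, if_pos rfl]; ring
    · rw [if_neg (by omega), if_pos hk, if_pos hk.le, if_neg (by omega)]; ring
  have h2 : ((-2 : ℂ) • (aeval J.toOp p * truncBelow n)
        + matElem (aeval J.toOp p) n n • (1 : BddOp)) u n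
      = -2 * aeval J.toOp p (truncBelow n u) n + matElem (aeval J.toOp p) n n * u n := rfl
  have h3 : (todaLax p J.coeffs - aeval J.toOp p) u n
      = todaLax p J.coeffs u n - aeval J.toOp p u n := rfl
  rw [h2, h3, aeval_apply_eq_of_toOp_eq p (toOp_truncBelow h), truncBelow_apply,
    if_pos le_rfl] at h1
  rw [todaH_eq]
  linear_combination h1

/-- The action of the Lax operator on vectors that solve the eigenvalue equation to the right. -/
theorem todaLax_apply_of_right {u : EllTwo} (h : ∀ k, n < k → J.toOp u k = z * u k) :
    todaLax p J.coeffs u n + (aeval J.toOp p u n - aeval z p * u n)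
      = 2 * J.a n * todaG p z J n * u (n + 1) - todaH p z J n * u n := by
  -- Mirror image: row n of p(J)_a + p(J) is 2p(J) right of the diagonal and 0 left of it, and the
  -- identity term supplies the diagonal entry.
  have h1 : (todaLax p J.coeffs + aeval J.toOp p) u n
      = ((2 : ℂ) • (aeval J.toOp p - aeval J.toOp p * truncBelow n)
        + matElem (aeval J.toOp p) n n • (1 : BddOp)) u n := by
    refine apply_eq_of_matElem_eq (fun k => ?_) u
    rw [matElem_add, matElem_todaLax_coeffs, matElem_add, matElem_smul, matElem_smul, matElem_sub,
      matElem_mul_truncBelow, matElem_one]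
    rcases lt_trichotomy n k with hk | rfl | hk
    · rw [if_pos hk, if_neg (by omega), if_neg (by omega)]; ring
    · rw [if_neg (by omega), if_neg (by omega), if_pos le_rfl, if_pos rfl]; ring
    · rw [if_neg (by omega), if_pos hk, if_pos hk.le, if_neg (by omega)]; ring
  have h2 : ((2 : ℂ) • (aeval J.toOp p - aeval J.toOp p * truncBelow n)
        + matElem (aeval J.toOp p) n n • (1 : BddOp)) u n
      = 2 * (aeval J.toOp p u n - aeval J.toOp p (truncBelow n u) n)
        + matElem (aeval J.toOp p) n n * u n := rfl
  have h2' : aeval J.toOp p u n - aeval J.toOp p (truncBelow n u) n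
      = aeval J.toOp p (u - truncBelow n u) n := by
    rw [map_sub]; rfl
  have h3 : (todaLax p J.coeffs + aeval J.toOp p) u n
      = todaLax p J.coeffs u n + aeval J.toOp p u n := rfl
  have h4 : J.toOp (u - truncBelow n u) = z • (u - truncBelow n u)
      + ((-(J.a n * u n)) • basisVec (n + 1) - (-(J.a n * u (n + 1))) • basisVec n) := by
    rw [toOp_sub_truncBelow h]
    module
  have h5 : (u - truncBelow n u) n = 0 := by
    change u n - truncBelow n u n = 0
    rw [truncBelow_apply, if_pos le_rfl, sub_self]
  rw [h2, h2', h3, aeval_apply_eq_of_toOp_eq p h4, h5] at h1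
  rw [todaH_eq]
  linear_combination h1

end RowFormula

/-! ### Transport of half-line solutions along the Toda flow -/

section Transport

open NormedSpace

/-- The operators `U exp (ε (p(J) - p(z)))`, with `U` the unitary factor of `exp (p(J))`. For
`ε = -1` they are lower triangular, for `ε = 1` upper triangular. -/
def transportOp (ε : ℝ) (p : ℝ[X]) (J : JacobiMatrix) (z : ℂ) : BddOp :=
  todaUnitary p J * exp (ε • (aeval J.toOp p - aeval z p • (1 : BddOp)))

variable (ε : ℝ) (p q : ℝ[X]) (J : JacobiMatrix) (z : ℂ)

theorem exp_smul_one (c : ℂ) : exp (c • (1 : BddOp)) = exp c • (1 : BddOp) := by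
  have h := algebraMap_exp_comm (𝔸 := BddOp) c
  rw [Algebra.algebraMap_eq_smul_one, Algebra.algebraMap_eq_smul_one] at h
  exact h.symm

theorem exp_sub_smul_one (A : BddOp) (c : ℂ) : exp (A - c • (1 : BddOp)) = exp (-c) • exp A := by
  rw [sub_eq_add_neg, ← neg_smul, expOp_add ((Commute.one_right A).smul_right (-c)), exp_smul_one,
    mul_smul_comm, mul_one]

theorem transportOp_neg_one_mem : transportOp (-1) p J z ∈ lowerTriangular := by
  have e : (-1 : ℝ) • (aeval J.toOp p - aeval z p • (1 : BddOp))
      = -aeval J.toOp p - (-aeval z p) • (1 : BddOp) := by module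
  intro j k hjk
  rw [transportOp, e, exp_sub_smul_one, mul_smul_comm, matElem_smul,
    (isDressing_todaUnitary p J).lower j k hjk, mul_zero]

theorem transportOp_one_mem : transportOp 1 p J z ∈ upperTriangular := by
  intro j k hjk
  rw [transportOp, one_smul, exp_sub_smul_one, mul_smul_comm, matElem_smul,
    (isDressing_todaUnitary p J).upper j k hjk, mul_zero]

theorem commute_aeval_toOp (A : BddOp) (c : ℂ) : Commute A (aeval A p - c • (1 : BddOp)) := by
  refine Commute.sub_right ?_ ((Commute.one_right A).smul_right c)
  have h := congrArg (aeval A) (mul_comm X p)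
  rwa [map_mul, map_mul, aeval_X] at h

/-- The exponential commutes with J, and U conjugates J to p · J. -/
theorem toOp_mul_transportOp :
    (todaMap p J).toOp * transportOp ε p J z = transportOp ε p J z * J.toOp := by
  have hc : Commute J.toOp (exp (ε • (aeval J.toOp p - aeval z p • (1 : BddOp)))) :=
    ((commute_aeval_toOp p J.toOp _).smul_right ε).exp_right
  have hU := Unitary.star_mul_self_of_mem (isDressing_todaUnitary p J).mem_unitary
  rw [toOp_todaMap, transportOp]
  calc todaUnitary p J * J.toOp * star (todaUnitary p J) * (todaUnitary p J
        * exp (ε • (aeval J.toOp p - aeval z p • (1 : BddOp))))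
      = todaUnitary p J * J.toOp * (star (todaUnitary p J) * todaUnitary p J)
        * exp (ε • (aeval J.toOp p - aeval z p • (1 : BddOp))) := by noncomm_ring
    _ = todaUnitary p J * (J.toOp * exp (ε • (aeval J.toOp p - aeval z p • (1 : BddOp)))) := by
      rw [hU]; noncomm_ring
    _ = _ := by rw [hc.eq, mul_assoc]

theorem transportOp_add :
    transportOp ε (p + q) J z = transportOp ε p (todaMap q J) z * transportOp ε q J z := by
  have hU := (isDressing_todaUnitary q J).mem_unitary
  have e : ε • (aeval J.toOp (p + q) - aeval z (p + q) • (1 : BddOp))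
      = ε • (aeval J.toOp q - aeval z q • (1 : BddOp))
        + ε • (aeval J.toOp p - aeval z p • (1 : BddOp)) := by
    rw [map_add, map_add]
    module
  have hc : Commute (ε • (aeval J.toOp q - aeval z q • (1 : BddOp)))
      (ε • (aeval J.toOp p - aeval z p • (1 : BddOp))) := by
    refine Commute.smul_left (Commute.smul_right ?_ ε) ε
    refine Commute.sub_left (Commute.sub_right ?_ ?_) ?_
    · rw [Commute, SemiconjBy, ← map_mul, ← map_mul, mul_comm]
    · exact (Commute.one_right _).smul_right _
    · exact (Commute.one_left _).smul_left _
  have e2 : todaUnitary q J * (ε • (aeval J.toOp p - aeval z p • (1 : BddOp)))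
      * star (todaUnitary q J)
      = ε • (aeval (todaMap q J).toOp p - aeval z p • (1 : BddOp)) := by
    rw [aeval_toOp_todaMap, mul_smul_comm, smul_mul_assoc, mul_sub, sub_mul, mul_smul_comm,
      smul_mul_assoc, mul_one, Unitary.mul_star_self_of_mem hU]
  rw [transportOp, e, todaUnitary_add, IsDressing.conj_aux hU hc, e2, transportOp, transportOp]

theorem transportOp_shift (n : ℤ) : transportOp ε p (J.shift n) z
    = translation n * transportOp ε p J z * star (translation n) := by
  have hn := translation_mem_unitary n
  have e : ε • (aeval (J.shift n).toOp p - aeval z p • (1 : BddOp))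
      = translation n * (ε • (aeval J.toOp p - aeval z p • (1 : BddOp)))
        * star (translation n) := by
    rw [J.toOp_shift, aeval_unitary_conj hn, mul_smul_comm, smul_mul_assoc, mul_sub, sub_mul,
      mul_smul_comm, smul_mul_assoc, mul_one, Unitary.mul_star_self_of_mem hn]
  rw [transportOp, e, expOp_unitary_conj hn, todaUnitary_shift, transportOp]
  calc translation n * todaUnitary p J * star (translation n) * (translation n
        * exp (ε • (aeval J.toOp p - aeval z p • (1 : BddOp))) * star (translation n))
      = translation n * todaUnitary p J * (star (translation n) * translation n)
        * exp (ε • (aeval J.toOp p - aeval z p • (1 : BddOp))) * star (translation n) := by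
        noncomm_ring
    _ = _ := by rw [Unitary.star_mul_self_of_mem hn]; noncomm_ring

variable {J z}

/-- Row k of a lower triangular W only uses sites l ≤ k, where A u = z u is known. -/
theorem solves_left_of_intertwine {A B W : BddOp} (hW : W ∈ lowerTriangular) (hc : B * W = W * A)
    {u : EllTwo} {m : ℤ} (h : ∀ k ≤ m, A u k = z * u k) : ∀ k ≤ m, B (W u) k = z * W u k := by
  intro k hk
  have h1 : B (W u) = W (A u) := congrArg (fun A : BddOp => A u) hc
  rw [h1]
  refine (hasSum_matElem_mul_apply W (A u) k).unique ?_
  convert! (hasSum_matElem_mul_apply W u k).mul_left z using 2 with l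
  rcases lt_or_ge k l with hl | hl
  · rw [hW k l hl]; ring
  · rw [h l (hl.trans hk)]; ring

theorem solves_right_of_intertwine {A B W : BddOp} (hW : W ∈ upperTriangular) (hc : B * W = W * A)
    {u : EllTwo} {m : ℤ} (h : ∀ k, m ≤ k → A u k = z * u k) : ∀ k, m ≤ k → B (W u) k = z * W u k := by
  intro k hk
  have h1 : B (W u) = W (A u) := congrArg (fun A : BddOp => A u) hc
  rw [h1]
  refine (hasSum_matElem_mul_apply W (A u) k).unique ?_
  convert! (hasSum_matElem_mul_apply W u k).mul_left z using 2 with l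
  rcases lt_or_ge l k with hl | hl
  · rw [hW k l hl]; ring
  · rw [h l (hk.trans hl)]; ring

theorem transportOp_solves_left {u : EllTwo} {m : ℤ} (h : ∀ k ≤ m, J.toOp u k = z * u k) :
    ∀ k ≤ m, (todaMap p J).toOp (transportOp (-1) p J z u) k = z * transportOp (-1) p J z u k :=
  solves_left_of_intertwine (transportOp_neg_one_mem p J z) (toOp_mul_transportOp (-1) p J z) h

theorem transportOp_solves_right {u : EllTwo} {m : ℤ} (h : ∀ k, m ≤ k → J.toOp u k = z * u k) :
    ∀ k, m ≤ k → (todaMap p J).toOp (transportOp 1 p J z u) k = z * transportOp 1 p J z u k :=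
  solves_right_of_intertwine (transportOp_one_mem p J z) (toOp_mul_transportOp 1 p J z) h

variable (J) in
/-- The initial data `(u_1, -a_0 u_0)` on which the transfer matrices act. -/
def initVec (u : EllTwo) : Fin 2 → ℂ := ![u 1, -(J.a 0) * u 0]

variable (J z) in
theorem hasDerivAt_transportOp (t : ℝ) :
    HasDerivAt (fun s : ℝ => transportOp ε (s • p) J z)
      ((todaLax p (todaMap (t • p) J).coeffs
        + ε • (aeval (todaMap (t • p) J).toOp p - aeval z p • (1 : BddOp)))
        * transportOp ε (t • p) J z) t := by
  have hU := (isTodaFlow_todaMap p J).exists_todaUnitary.2.2 t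
  have hUu := (isDressing_todaUnitary (t • p) J).mem_unitary
  have h := hasDerivAt_mul_exp hU hUu (ε • (aeval J.toOp p - aeval z p • (1 : BddOp)))
  have e : ∀ s : ℝ, s • ε • (aeval J.toOp p - aeval z p • (1 : BddOp))
      = ε • (aeval J.toOp (s • p) - aeval z (s • p) • (1 : BddOp)) := fun s => by
    rw [map_smul, map_smul, smul_comm s ε, smul_sub s, smul_assoc s (aeval z p)]
  simp only [e] at h
  convert! h using 3
  rw [aeval_toOp_todaMap, mul_smul_comm, smul_mul_assoc, mul_sub, sub_mul, mul_smul_comm,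
      smul_mul_assoc, mul_one, Unitary.mul_star_self_of_mem hUu]

theorem hasDerivAt_a_zero (t : ℝ) :
    HasDerivAt (fun s : ℝ => ((todaMap (s • p) J).a 0 : ℂ))
      ((todaMap (t • p) J).a 0 * (matElem (aeval (todaMap (t • p) J).toOp p) 1 1
        - matElem (aeval (todaMap (t • p) J).toOp p) 0 0)) t := by
  obtain ⟨Y, hY, hd⟩ := (isTodaFlow_todaMap p J).2 t
  rw [hY.unique (isAntisymmPart_todaLax p _)] at hd
  have h := hasDerivAt_matElem hd 0 (0 + 1)
  have h2 := matElem_todaCommutator_succ p (todaMap (t • p) J).coeffs 0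
  rw [todaCommutator, JacobiMatrix.tridiagonal_coeffs] at h2
  simp only [JacobiMatrix.matElem_toOp_succ] at h
  rw [h2] at h
  simpa only [zero_add, JacobiMatrix.coeffs_fst_apply] using h

/-- Both sides solve the planar system with matrix B_p and the same initial value. The hypotheses
are exactly what closes the system in the data at the sites 0 and 1. -/
theorem todaTransfer_mulVec_of_rows {u : EllTwo}
    (heq : ∀ t : ℝ, (todaMap (t • p) J).toOp (transportOp ε (t • p) J z u) 1
      = z * transportOp ε (t • p) J z u 1)
    (hrow : ∀ t : ℝ, ∀ n : ℤ, n = 0 ∨ n = 1 →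
      (todaLax p (todaMap (t • p) J).coeffs
        + ε • (aeval (todaMap (t • p) J).toOp p - aeval z p • (1 : BddOp)))
        (transportOp ε (t • p) J z u) n
      = 2 * (todaMap (t • p) J).a n * todaG p z (todaMap (t • p) J) n
          * transportOp ε (t • p) J z u (n + 1)
        - todaH p z (todaMap (t • p) J) n * transportOp ε (t • p) J z u n) :
    todaTransfer p J z *ᵥ initVec J u = initVec (todaMap p J) (transportOp ε p J z u) := by
  have hc : ∀ (t : ℝ) (n : ℤ), n = 0 ∨ n = 1 →
      HasDerivAt (fun s : ℝ => transportOp ε (s • p) J z u n)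
      (2 * (todaMap (t • p) J).a n * todaG p z (todaMap (t • p) J) n
          * transportOp ε (t • p) J z u (n + 1)
        - todaH p z (todaMap (t • p) J) n * transportOp ε (t • p) J z u n) t := fun t n hn => by
    rw [← hrow t n hn]
    have h := (((coordL n).restrictScalars ℝ).comp
      ((ContinuousLinearMap.apply ℂ EllTwo u).restrictScalars ℝ)).hasFDerivAt.comp_hasDerivAt t
      (hasDerivAt_transportOp ε p J z t)
    exact h
  have hM := isTodaTransfer_todaTransfer p J z
  have hp : (1 : ℝ) • p = p := one_smul _ _
  have key := eq_of_planar_solutions (continuous_todaB_todaMap p J z)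
    (x := fun t : ℝ => todaTransfer (t • p) J z *ᵥ initVec J u)
    (y := fun t : ℝ => initVec (todaMap (t • p) J) (transportOp ε (t • p) J z u))
    (fun t i => ?_) (fun t i => ?_) ?_
  · simpa only [hp] using congrFun key 1
  · have h := ((hM.2 t i 0).mul_const (initVec J u 0)).add ((hM.2 t i 1).mul_const (initVec J u 1))
    convert! h using 1
    · funext s
      simp [mulVec, dotProduct, Fin.sum_univ_two]
    · rw [mulVec_mulVec]
      simp [mulVec, dotProduct, Fin.sum_univ_two]
  · have h1 : (todaMap (t • p) J).a 1 * transportOp ε (t • p) J z u 2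
        + (todaMap (t • p) J).a 0 * transportOp ε (t • p) J z u 0
        + (todaMap (t • p) J).b 1 * transportOp ε (t • p) J z u 1
        = z * transportOp ε (t • p) J z u 1 := by
      rw [← heq t, JacobiMatrix.toOp_apply]
      rfl
    have h2 := todaH_zero_add_todaH_one z (todaMap (t • p) J) p
    have h3 := hasDerivAt_a_zero (J := J) p t
    rw [h2] at h3
    fin_cases i
    · convert! hc t 1 (Or.inr rfl) using 1
      simp [mulVec, dotProduct, Fin.sum_univ_two, todaB, initVec]
      -- The eigenvalue equation at site 1 eliminates u_2 in favour of u_0 and u_1.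
      linear_combination (-2) * todaG p z (todaMap (t • p) J) 1 * h1
    -- Differentiating -a_0 u_0, the terms with H_0 from a_0' and from u_0' cancel.
    · convert! (h3.mul (hc t 0 (Or.inl rfl))).neg using 1
      · funext s
        simp [initVec]
      · simp [mulVec, dotProduct, Fin.sum_univ_two, todaB, initVec]
        ring
  · have h0 : todaTransfer ((0 : ℝ) • p) J z = 1 := hM.1
    rw [h0, one_mulVec, zero_smul, todaMap_zero, transportOp, todaUnitary_zero]
    simp

/-- The row formula at n = 1 uses the equation up to site 1. -/
theorem todaTransfer_mulVec_of_left {u : EllTwo} (h : ∀ k ≤ 1, J.toOp u k = z * u k) :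
    todaTransfer p J z *ᵥ initVec J u
      = initVec (todaMap p J) (transportOp (-1) p J z u) := by
  have hs := fun t : ℝ => transportOp_solves_left (t • p) h
  refine todaTransfer_mulVec_of_rows (-1) p (fun t => hs t 1 le_rfl) fun t n hn => ?_
  rw [← todaLax_apply_of_left p fun k hk => hs t k (hk.trans (by omega)), neg_one_smul,
    ← sub_eq_add_neg]
  rfl

/-- The row formula at n = 0 uses the equation at all k > 0, so starting at site 1 is just enough.
-/
theorem todaTransfer_mulVec_of_right {u : EllTwo} (h : ∀ k, 1 ≤ k → J.toOp u k = z * u k) :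
    todaTransfer p J z *ᵥ initVec J u = initVec (todaMap p J) (transportOp 1 p J z u) := by
  have hs := fun t : ℝ => transportOp_solves_right (t • p) h
  refine todaTransfer_mulVec_of_rows 1 p (fun t => hs t 1 le_rfl) fun t n hn => ?_
  rw [← todaLax_apply_of_right p fun k hk => hs t k (by omega), one_smul]
  rfl

end Transport

/-! ### Spanning by half-line solutions for nonreal z -/

section Spanning

variable {J : JacobiMatrix} {z : ℂ}

/-- J is self-adjoint, so its spectrum is real. -/
theorem exists_resolvent (J : JacobiMatrix) (hz : z.im ≠ 0) :
    ∃ R : BddOp, (∀ u, J.toOp (R u) - z • R u = u) ∧ ∀ u, R (J.toOp u - z • u) = u := by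
  have h : z ∉ spectrum ℂ J.toOp := fun h =>
    hz (IsSelfAdjoint.im_eq_zero_of_mem_spectrum (a := J.toOp) J.star_toOp h)
  obtain ⟨V, hV⟩ := spectrum.notMem_iff.1 h
  have hV' : ∀ u, (V : BddOp) u = z • u - J.toOp u := fun u => by
    rw [hV, Algebra.algebraMap_eq_smul_one]
    rfl
  refine ⟨-(↑V⁻¹ : BddOp), fun u => ?_, fun u => ?_⟩
  · have h1 : (V : BddOp) ((↑V⁻¹ : BddOp) u) = u := congrArg (fun A : BddOp => A u) V.mul_inv
    rw [hV'] at h1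
    have e : (-(↑V⁻¹ : BddOp)) u = -((↑V⁻¹ : BddOp) u) := rfl
    rw [e, map_neg, smul_neg]
    nth_rewrite 3 [← h1]
    abel
  · have h1 : (↑V⁻¹ : BddOp) ((V : BddOp) u) = u := congrArg (fun A : BddOp => A u) V.inv_mul
    rw [hV'] at h1
    have e : (-(↑V⁻¹ : BddOp)) (J.toOp u - z • u)
        = (↑V⁻¹ : BddOp) (z • u - J.toOp u) := by
      rw [← neg_sub (J.toOp u), map_neg]; rfl
    rw [e, h1]

theorem initVec_add (J : JacobiMatrix) (u v : EllTwo) :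
    initVec J (u + v) = initVec J u + initVec J v := by
  ext i
  fin_cases i
  · rfl
  · change -(J.a 0 : ℂ) * (u 0 + v 0) = -(J.a 0 : ℂ) * u 0 + -(J.a 0 : ℂ) * v 0
    ring

/-- For nonreal `z`, every initial datum is the sum of the data of a vector that solves the
eigenvalue equation to the left and of one that solves it to the right. -/
theorem exists_initVec_eq (J : JacobiMatrix) (hz : z.im ≠ 0) (x : Fin 2 → ℂ) :
    ∃ u v : EllTwo, (∀ k ≤ 2, J.toOp u k = z * u k) ∧ (∀ k, 1 ≤ k → J.toOp v k = z * v k) ∧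
      initVec J u + initVec J v = x := by
  obtain ⟨R, hR, hR'⟩ := exists_resolvent J hz
  have ha : ∀ n, (J.a n : ℂ) ≠ 0 := fun n => Complex.ofReal_ne_zero.2 (J.a_pos n).ne'
  let w0 : ℂ := -(x 1) / J.a 0
  let w1 : ℂ := x 0
  -- w_0 and w_1 encode the prescribed datum x; w_2 and w_3 continue the recursion so that (J - z)w
  -- vanishes at sites 1 and 2.
  let w2 : ℂ := ((z - J.b 1) * w1 - J.a 0 * w0) / J.a 1
  let w3 : ℂ := ((z - J.b 2) * w2 - J.a 1 * w1) / J.a 2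
  let w : EllTwo := w0 • basisVec 0 + w1 • basisVec 1 + w2 • basisVec 2 + w3 • basisVec 3
  have hw : ∀ k, w k = w0 * basisVec 0 k + w1 * basisVec 1 k + w2 * basisVec 2 k
    + w3 * basisVec 3 k := fun k => rfl
  have hw0 : w 0 = w0 := by simp [hw]
  have hw1 : w 1 = w1 := by simp [hw]
  have hw2 : w 2 = w2 := by simp [hw]
  have hw3 : w 3 = w3 := by simp [hw]
  set f : EllTwo := J.toOp w - z • w with hf
  have hfk : ∀ k, f k = J.toOp w k - z * w k := fun k => rfl
  have hf1 : f 1 = 0 := by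
    have h : J.toOp w 1 = J.a 1 * w 2 + J.a 0 * w 0 + J.b 1 * w 1 := J.toOp_apply w 1
    rw [hfk, h, hw0, hw1, hw2]
    simp only [w2]
    field_simp [ha 1]
    ring
  have hf2 : f 2 = 0 := by
    have h : J.toOp w 2 = J.a 2 * w 3 + J.a 1 * w 1 + J.b 2 * w 2 := J.toOp_apply w 2
    rw [hfk, h, hw1, hw2, hw3]
    simp only [w3]
    field_simp [ha 2]
    ring
  have hsolve : ∀ (g : EllTwo) k, g k = 0 → J.toOp (R g) k = z * R g k := fun g k hg => by
    have h : (J.toOp (R g) - z • R g) k = J.toOp (R g) k - z * R g k := rfl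
    rw [hR, hg] at h
    exact (sub_eq_zero.1 h.symm)
  -- Split w = R f by splitting f between sites 2 and 3; each piece solves the equation where its
  -- source vanishes. As f also vanishes at 1 and 2, the two regions overlap there. Reaching site 2
  -- on the left leaves room for one translation.
  refine ⟨R (f - truncBelow 2 f), R (truncBelow 2 f), fun k hk => hsolve _ k ?_,
    fun k hk => hsolve _ k ?_, ?_⟩
  · change f k - truncBelow 2 f k = 0
    rw [truncBelow_apply, if_pos hk, sub_self]
  · rw [truncBelow_apply]
    split_ifs with h
    · rcases (show k = 1 ∨ k = 2 by omega) with rfl | rfl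
      · exact hf1
      · exact hf2
    · rfl
  · rw [← initVec_add, ← map_add, sub_add_cancel, hf, hR']
    ext i
    fin_cases i
    · exact hw1
    · change -(J.a 0 : ℂ) * w 0 = x 1
      rw [hw0]
      simp only [w0]
      field_simp [ha 0]

theorem eq_of_mulVec_initVec (J : JacobiMatrix) (hz : z.im ≠ 0) {M N : Matrix (Fin 2) (Fin 2) ℂ}
    (hl : ∀ u : EllTwo, (∀ k ≤ 2, J.toOp u k = z * u k) → M *ᵥ initVec J u = N *ᵥ initVec J u)
    (hr : ∀ u : EllTwo, (∀ k, 1 ≤ k → J.toOp u k = z * u k) →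
      M *ᵥ initVec J u = N *ᵥ initVec J u) : M = N := by
  refine Matrix.ext_of_mulVec_single fun i => ?_
  obtain ⟨u, v, hu, hv, huv⟩ := exists_initVec_eq J hz (Pi.single i 1)
  rw [← huv, mulVec_add, mulVec_add, hl u hu, hr v hv]

theorem SLEntire.ext_of_nonreal {T U : SLEntire}
    (h : ∀ z : ℂ, z.im ≠ 0 → SLEntire.eval T z = SLEntire.eval U z) : T = U := by
  have hd : Dense {z : ℂ | z.im ≠ 0} := (dense_compl_singleton (0 : ℝ)).preimage Complex.isOpenMap_im
  refine Subtype.ext (funext fun z => Subtype.ext ?_)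
  ext i j
  exact congrFun ((T.2.1 i j).continuous.ext_on hd (U.2.1 i j).continuous fun z hz => by
    exact congrFun (congrFun (h z hz) i) j) z

@[simp] theorem SLEntire.eval_mul (T U : SLEntire) (z : ℂ) :
    SLEntire.eval (T * U) z = SLEntire.eval T z * SLEntire.eval U z := rfl

end Spanning

/-! ### The cocycle identities -/

section Cocycle

/-- On data of half-line solutions both sides compute the data of the transported vector, and the
transport operators compose. -/
theorem todaTransferSL_add (p q : ℝ[X]) (J : JacobiMatrix) :
    todaTransferSL (p + q) J = todaTransferSL p (todaMap q J) * todaTransferSL q J := by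
  refine SLEntire.ext_of_nonreal fun z hz => eq_of_mulVec_initVec J hz (fun u hu => ?_)
    fun u hu => ?_
  · have hu1 : ∀ k ≤ 1, J.toOp u k = z * u k := fun k hk => hu k (hk.trans (by norm_num))
    rw [SLEntire.eval_mul, ← mulVec_mulVec]
    simp only [eval_todaTransferSL]
    rw [todaTransfer_mulVec_of_left q hu1,
      todaTransfer_mulVec_of_left p (transportOp_solves_left q hu1),
      todaTransfer_mulVec_of_left (p + q) hu1, transportOp_add, todaMap_add]
    rfl
  · rw [SLEntire.eval_mul, ← mulVec_mulVec]
    simp only [eval_todaTransferSL]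
    rw [todaTransfer_mulVec_of_right q hu,
      todaTransfer_mulVec_of_right p (transportOp_solves_right q hu),
      todaTransfer_mulVec_of_right (p + q) hu, transportOp_add, todaMap_add]
    rfl

variable {J : JacobiMatrix} {z : ℂ}

/-- The equation at site 1 expresses u_2 through u_1 and u_0; the new datum (u_2, -a_1 u_1) is that
of the translated vector. -/
theorem stepMatrix_mulVec_initVec {u : EllTwo} (h : J.toOp u 1 = z * u 1) :
    SLEntire.eval (stepMatrix J) z *ᵥ initVec J u = initVec (J.shift 1) (translation 1 u) := by
  have ha : (J.a 1 : ℂ) ≠ 0 := Complex.ofReal_ne_zero.2 (J.a_pos 1).ne'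
  have h1 : J.a 1 * u 2 + J.a 0 * u 0 + J.b 1 * u 1 = z * u 1 := by
    rw [← h, J.toOp_apply]
    rfl
  change !![(z - J.b 1) / J.a 1, 1 / J.a 1; -(J.a 1 : ℂ), 0] *ᵥ initVec J u = _
  ext i
  fin_cases i
  · have e : translation 1 u 1 = u 2 := translation_apply 1 u 1
    simp [mulVec, dotProduct, Fin.sum_univ_two, initVec, e]
    field_simp
    linear_combination -h1
  · have e : translation 1 u 0 = u 1 := translation_apply 1 u 0
    simp [mulVec, dotProduct, Fin.sum_univ_two, initVec, e, JacobiMatrix.shift]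

theorem toOp_shift_translation_apply (u : EllTwo) (n k : ℤ) :
    (J.shift n).toOp (translation n u) k = J.toOp u (k + n) := by
  rw [JacobiMatrix.toOp_apply, JacobiMatrix.toOp_apply]
  simp only [translation_apply, JacobiMatrix.shift]
  rw [show k + 1 + n = k + n + 1 by ring, show k - 1 + n = k + n - 1 by ring]

theorem transportOp_shift_translation (ε : ℝ) (p : ℝ[X]) (n : ℤ) (u : EllTwo) :
    transportOp ε p (J.shift n) z (translation n u) = translation n (transportOp ε p J z u) := by
  have h : transportOp ε p (J.shift n) z * translation n = translation n * transportOp ε p J z := by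
    rw [transportOp_shift, mul_assoc, Unitary.star_mul_self_of_mem (translation_mem_unitary n),
      mul_one]
  exact congrArg (fun A : BddOp => A u) h

/-- Transport and translation commute, so both orders give the data of the same vector. For left
solutions the equation is needed up to site 2, since translation moves it down to site 1. -/
theorem todaTransferSL_shift_one (p : ℝ[X]) (J : JacobiMatrix) :
    todaTransferSL p (J.shift 1) * stepMatrix J
      = stepMatrix (todaMap p J) * todaTransferSL p J := by
  refine SLEntire.ext_of_nonreal fun z hz => eq_of_mulVec_initVec J hz (fun u hu => ?_)
    fun u hu => ?_
  · have hu1 : ∀ k ≤ 1, J.toOp u k = z * u k := fun k hk => hu k (hk.trans (by norm_num))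
    have hs : ∀ k ≤ 1, (J.shift 1).toOp (translation 1 u) k = z * translation 1 u k := fun k hk => by
      rw [toOp_shift_translation_apply, translation_apply]
      exact hu _ (by omega)
    rw [SLEntire.eval_mul, SLEntire.eval_mul, ← mulVec_mulVec, ← mulVec_mulVec,
      stepMatrix_mulVec_initVec (hu1 1 le_rfl)]
    simp only [eval_todaTransferSL]
    rw [todaTransfer_mulVec_of_left p hs, todaTransfer_mulVec_of_left p hu1,
      stepMatrix_mulVec_initVec (transportOp_solves_left p hu1 1 le_rfl),
      transportOp_shift_translation, todaMap_shift]
  · have hs : ∀ k, 1 ≤ k → (J.shift 1).toOp (translation 1 u) k = z * translation 1 u k :=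
      fun k hk => by
      rw [toOp_shift_translation_apply, translation_apply]
      exact hu _ (by omega)
    rw [SLEntire.eval_mul, SLEntire.eval_mul, ← mulVec_mulVec, ← mulVec_mulVec,
      stepMatrix_mulVec_initVec (hu 1 le_rfl)]
    simp only [eval_todaTransferSL]
    rw [todaTransfer_mulVec_of_right p hs, todaTransfer_mulVec_of_right p hu,
      stepMatrix_mulVec_initVec (transportOp_solves_right p hu 1 le_rfl),
      transportOp_shift_translation, todaMap_shift]

theorem shiftTransferNat_succ' (n : ℕ) (J : JacobiMatrix) :
    shiftTransferNat (n + 1) J = shiftTransferNat n (J.shift 1) * stepMatrix J := by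
  induction n with
  | zero =>
    change stepMatrix (J.shift 0) * 1 = 1 * stepMatrix J
    rw [shift_zero, mul_one, one_mul]
  | succ n ih =>
    change stepMatrix (J.shift ((n + 1 : ℕ) : ℤ)) * shiftTransferNat (n + 1) J
      = stepMatrix ((J.shift 1).shift n) * shiftTransferNat n (J.shift 1) * stepMatrix J
    rw [ih, shift_shift, mul_assoc]
    rfl

theorem shiftTransfer_neg (n : ℕ) (J : JacobiMatrix) :
    shiftTransfer (-(n : ℤ)) J = (shiftTransferNat n (J.shift (-(n : ℤ))))⁻¹ := by
  cases n with
  | zero => exact inv_one.symm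
  | succ n => rfl

theorem shiftTransfer_add_one (n : ℤ) (J : JacobiMatrix) :
    shiftTransfer (n + 1) J = stepMatrix (J.shift n) * shiftTransfer n J := by
  obtain ⟨k, rfl | rfl⟩ := n.eq_nat_or_neg
  · rfl
  · cases k with
    | zero => rfl
    | succ k =>
      rw [show -((k + 1 : ℕ) : ℤ) + 1 = -(k : ℤ) by push_cast; ring, shiftTransfer_neg,
        shiftTransfer_neg, shiftTransferNat_succ', shift_shift,
        show 1 + -((k + 1 : ℕ) : ℤ) = -(k : ℤ) by push_cast; ring, _root_.mul_inv_rev,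
        mul_inv_cancel_left]

theorem shiftTransfer_zero (J : JacobiMatrix) : shiftTransfer 0 J = 1 := rfl

/-- Passing from n to n + 1 multiplies both sides by the same invertible step matrix, so the
identities at n and n + 1 are equivalent, and induction runs in both directions from n = 0. -/
theorem shiftTransfer_add (n m : ℤ) (J : JacobiMatrix) :
    shiftTransfer (n + m) J = shiftTransfer n (J.shift m) * shiftTransfer m J := by
  have hstep : ∀ n : ℤ,
      shiftTransfer (n + m) J = shiftTransfer n (J.shift m) * shiftTransfer m J ↔
      shiftTransfer (n + 1 + m) J = shiftTransfer (n + 1) (J.shift m) * shiftTransfer m J :=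
    fun n => by
    rw [add_right_comm, shiftTransfer_add_one, shiftTransfer_add_one, shift_shift, mul_assoc,
      mul_right_inj]
  induction n using Int.induction_on with
  | zero => rw [zero_add, shiftTransfer_zero, one_mul]
  | succ n ih => exact (hstep _).1 ih
  | pred n ih =>
    refine (hstep _).2 ?_
    rwa [sub_add_cancel]

/-- The commutation with one step makes the statements at n and n + 1 equivalent, so it propagates
from n = 0 to all integers. -/
theorem todaTransferSL_shift (p : ℝ[X]) (n : ℤ) (J : JacobiMatrix) :
    todaTransferSL p (J.shift n) * shiftTransfer n J
      = shiftTransfer n (todaMap p J) * todaTransferSL p J := by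
  have hstep : ∀ n : ℤ, todaTransferSL p (J.shift n) * shiftTransfer n J
      = shiftTransfer n (todaMap p J) * todaTransferSL p J ↔
      todaTransferSL p (J.shift (n + 1)) * shiftTransfer (n + 1) J
      = shiftTransfer (n + 1) (todaMap p J) * todaTransferSL p J := fun n => by
    rw [shiftTransfer_add_one, shiftTransfer_add_one, ← mul_assoc, add_comm n 1, ← shift_shift,
      todaTransferSL_shift_one, mul_assoc, mul_assoc, todaMap_shift, mul_right_inj]
  induction n using Int.induction_on with
  | zero => rw [shift_zero, shiftTransfer_zero, shiftTransfer_zero, one_mul, mul_one]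
  | succ n ih => exact (hstep _).1 ih
  | pred n ih =>
    refine (hstep _).2 ?_
    rwa [sub_add_cancel]

/-- The joint cocycle of the Toda maps and the shift. -/
def todaCocycle (g : ℝ[X] × ℤ) (J : JacobiMatrix) : SLEntire :=
  todaTransferSL g.1 (J.shift g.2) * shiftTransfer g.2 J

theorem todaCocycle_add (g h : ℝ[X] × ℤ) (J : JacobiMatrix) :
    todaCocycle (g + h) J = todaCocycle g (todaMap h.1 (J.shift h.2)) * todaCocycle h J := by
  obtain ⟨p, n⟩ := g
  obtain ⟨q, m⟩ := h
  change todaTransferSL (p + q) (J.shift (n + m)) * shiftTransfer (n + m) J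
    = todaTransferSL p ((todaMap q (J.shift m)).shift n) * shiftTransfer n (todaMap q (J.shift m))
      * (todaTransferSL q (J.shift m) * shiftTransfer m J)
  rw [todaTransferSL_add, shiftTransfer_add, ← shift_shift, ← todaMap_shift]
  simp only [mul_assoc]
  rw [← mul_assoc (shiftTransfer n (todaMap q (J.shift m))), ← todaTransferSL_shift]
  simp only [mul_assoc]

end Cocycle

end

theorem theorem1p1 :
    -- the Toda flows exist globally, are unique, and `t ↦ tp · J` is the flow of `p` through `J`
    (∀ (p : ℝ[X]) (J : JacobiMatrix),
      IsTodaFlow p J (fun t : ℝ => todaMap (t • p) J) ∧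
      ∀ γ : ℝ → JacobiMatrix, IsTodaFlow p J γ → γ = fun t : ℝ => todaMap (t • p) J) ∧
    -- the same for the linear equation that defines `T(p; J)`
    (∀ (p : ℝ[X]) (J : JacobiMatrix) (z : ℂ),
      IsTodaTransfer p J z (fun t : ℝ => todaTransfer (t • p) J z) ∧
      ∀ M : ℝ → Matrix (Fin 2) (Fin 2) ℂ, IsTodaTransfer p J z M →
        M = fun t : ℝ => todaTransfer (t • p) J z) ∧
    -- `(p, n) · J = p · S^n J = S^n (p · J)` is an action, and `T` is a cocycle for it
    ∃ (_ : AddAction (ℝ[X] × ℤ) JacobiMatrix) (T : ℝ[X] × ℤ → JacobiMatrix → SLEntire),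
      (∀ (p : ℝ[X]) (n : ℤ) (J : JacobiMatrix),
        ((p, n) : ℝ[X] × ℤ) +ᵥ J = todaMap p (J.shift n) ∧
        ((p, n) : ℝ[X] × ℤ) +ᵥ J = (todaMap p J).shift n) ∧
      (∀ (p : ℝ[X]) (n : ℤ) (J : JacobiMatrix) (z : ℂ),
        SLEntire.eval (T (p, n) J) z = todaTransfer p (J.shift n) z * SLEntire.eval (shiftTransfer n J) z ∧
        SLEntire.eval (T (p, n) J) z = SLEntire.eval (shiftTransfer n (todaMap p J)) z * todaTransfer p J z) ∧
      IsSLCocycle T := by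
  refine ⟨fun p J => ⟨isTodaFlow_todaMap p J, fun γ hγ => hγ.eq_todaMap⟩,
    fun p J z => ⟨isTodaTransfer_todaTransfer p J z, fun M hM => hM.eq_todaTransfer⟩,
    todaAction, todaCocycle, fun p n J => ⟨rfl, todaMap_shift p n J⟩, fun p n J z => ⟨rfl, ?_⟩,
    fun g h J => todaCocycle_add g h J⟩
  rw [todaCocycle, todaTransferSL_shift]
  rfl
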